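/- **Setting.** An NRA specification $\varphi(X,y)$, $X=(x_1,\dots,x_m)$, is a Boolean combination of inequalities $p\bowtie 0$ with $p\in\mathbb{Q}[X,y]$ and ${\bowtie}\in\{<,>,\le,\ge\}$, interpreted over $\mathbb{R}$; $X$ are the inputs and $y$ is the single output. We write $\varphi$ without negations ($\neg(p\le 0)$ becomes $p>0$, etc.). Let $\mathrm{NonStrict}(\varphi)$ be the set of polynomials $p$ containing $y$ that occur in non-strict inequalities of $\varphi$, and let $\widehat\varphi$ be obtained from $\varphi$ by making strict every non-strict inequality whose polynomial contains $y$. Let $\psi(X)$ be a quantifier-free formula equivalent over $\mathbb{R}$ to $\exists y\,\widehat\varphi(X,y)$. Programs are imperative programs over rational-valued variables built from assignments of polynomial terms, conditionals and while loops guarded by polynomial constraints, sequencing, return of variables or of $\bot$, and loops over the finite lists returned by two modules, which are evaluated at the current input $A$: - $\mathsf{CandRatRoot}(p=0)$ clears the denominators of $p(A,y)$, splits off the largest power of $y$ dividing it (giving the candidate $0$ if this power is not $1$), and lists all $\pm u/v$ with $u$ a positive factor of the lowest and $v$ a positive factor of the highest remaining coefficient; the list is empty if $p(A,y)$ is the zero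 polynomial. - $\mathsf{RationalSamplesNRA}(\chi)$ isolates the real roots of the product of those polynomials of $\chi(A,y)$ that are not identically zero, by disjoint open intervals $(l_1,u_1),\dots,(l_k,u_k)$ with rational end points, in increasing order, and returns $l_1-1,\frac{u_1+l_2}{2},\dots,\frac{u_{k-1}+l_k}{2},u_k+1$ (the point $0$ if $k=0$). The program $\mathsf{Prog}_{\varphi}(X)$ is: if $\psi(X)$ holds, then for all $a$ in $\mathsf{RationalSamplesNRA}(\widehat\varphi)$, return $a$ if $\widehat\varphi(X,a)$; otherwise, for all $p\in\mathrm{NonStrict}(\varphi)$ and all $a$ in $\mathsf{CandRatRoot}(p=0)$, return $a$ if $\varphi(X,a)$; finally return $\bot$. A program *realizes $\varphi$ at* $A\in\mathbb{Q}^m$ if on input $A$ it terminates and returns either some $b\in\mathbb{Q}$ with $\varphi(A,b)$, or $\bot$, the latter if and only if no $b\in\mathbb{Q}$ satisfies $\varphi(A,b)$. It *realizes $\varphi$ over the rationals* if it does so at every $A\in\mathbb{Q}^m$. Let $\varphi^{+}$ be obtained from $\varphi$ (written without negations) by replacing every non-strict inequality $p\bowtie 0$ whose polynomial $p=c_0(X)+c_1(X)y+\dots+c_d(X)y^d$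 contains $y$ by $p\bowtie 0\,\vee\,(c_0(X)=0\wedge\dots\wedge c_d(X)=0)$. **Theorem.** Let $\varphi(X,y)$ be any NRA specification with a single output variable. 1. Formulas $\psi$ as required exist, both for $\varphi$ and for $\varphi^{+}$. 2. For every such $\psi$ for $\varphi$, the program $\mathsf{Prog}_{\varphi}$ terminates on every input $A\in\mathbb{Q}^m$, and if it returns $b\in\mathbb{Q}$, then $\varphi(A,b)$ holds. It realizes $\varphi$ at every $A\in\mathbb{Q}^m$ for which no $p\in\mathrm{NonStrict}(\varphi)$ becomes the zero polynomial $p(A,y)$; hence it realizes $\varphi$ over the rationals if there is no rational input at which this happens. 3. In full generality, $\varphi^{+}$ is equivalent to $\varphi$ over $\mathbb{R}$, and for every such $\psi$ for $\varphi^{+}$, the program $\mathsf{Prog}_{\varphi^{+}}$ realizes $\varphi$ over the rationals. So every single-output NRA specification is realized over the rationals by a program obtained from this construction. -/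

import Mathlib

noncomputable section

namespace NRA

open scoped Classical

/-! ### Polynomial constraints -/

/-- The four comparison symbols of a polynomial inequality `p ⋈ 0`. -/
inductive Rel
  | lt | gt | le | ge

namespace Rel

/-- `a ⋈ 0`. -/
def Holds {K : Type*} [Zero K] [LT K] [LE K] : Rel → K → Prop
  | lt, a => a < 0
  | gt, a => a > 0
  | le, a => a ≤ 0
  | ge, a => a ≥ 0

/-- The comparison equivalent to `¬ (a ⋈ 0)` in a linear order. -/
def neg : Rel → Rel
  | lt => ge
  | gt => le
  | le => gt
  | ge => lt

/-- The strict version of a comparison. -/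
def strict : Rel → Rel
  | lt => lt
  | gt => gt
  | le => lt
  | ge => gt

/-- `⋈` is one of `≤`, `≥`. -/
def IsNonStrict : Rel → Prop
  | lt => False
  | gt => False
  | le => True
  | ge => True

end Rel

/-- Boolean combinations of polynomial inequalities `p ⋈ 0` with rational coefficients in the
variables `V` (an equation `p = 0` is `p ≤ 0 ∧ p ≥ 0`). -/
inductive Formula (V : Type)
  | atom (p : MvPolynomial V ℚ) (r : Rel)
  | not (f : Formula V)
  | and (f g : Formula V)
  | or (f g : Formula V)

namespace Formula

variable {V W : Type}

/-- Truth of a formula at a valuation with values in `K` (used for `K = ℝ` and `K = ℚ`). -/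
def Holds {K : Type*} [CommRing K] [LinearOrder K] [Algebra ℚ K] :
    Formula V → (V → K) → Prop
  | atom p r, v => r.Holds (MvPolynomial.aeval v p)
  | not f, v => ¬ f.Holds v
  | and f g, v => f.Holds v ∧ g.Holds v
  | or f g, v => f.Holds v ∨ g.Holds v

/-- Replace every atom `p ⋈ 0` by the formula `s p ⋈`. -/
def bind (s : MvPolynomial V ℚ → Rel → Formula W) : Formula V → Formula W
  | atom p r => s p r
  | not f => not (f.bind s)
  | and f g => and (f.bind s) (g.bind s)
  | or f g => or (f.bind s) (g.bind s)

/-- Renaming of variables. -/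
def rename (e : V → W) (f : Formula V) : Formula W :=
  f.bind fun p r => atom (MvPolynomial.rename e p) r

/-- The list of all atoms of a formula. -/
def atoms : Formula V → List (MvPolynomial V ℚ × Rel)
  | atom p r => [(p, r)]
  | not f => f.atoms
  | and f g => f.atoms ++ g.atoms
  | or f g => f.atoms ++ g.atoms

/-- `nnfAux true f` is `f`, and `nnfAux false f` is `¬ f`, with all negations pushed to the
atoms and absorbed there (`¬ (p ≤ 0)` becomes `p > 0`, and so on). -/
def nnfAux : Bool → Formula V → Formula V
  | true, atom p r => atom p r
  | false, atom p r => atom p r.neg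
  | b, not f => nnfAux (!b) f
  | true, and f g => and (nnfAux true f) (nnfAux true g)
  | false, and f g => or (nnfAux false f) (nnfAux false g)
  | true, or f g => or (nnfAux true f) (nnfAux true g)
  | false, or f g => and (nnfAux false f) (nnfAux false g)

/-- The negation-free form of a formula. -/
def nnf (f : Formula V) : Formula V := nnfAux true f

/-- The formula `p = 0`. -/
def eqZero (p : MvPolynomial V ℚ) : Formula V := and (atom p Rel.le) (atom p Rel.ge)

/-- A formula that is always true. -/
def tru : Formula V := atom 0 Rel.le

end Formula

/-- Specifications `φ(X, Y)` with inputs `X = (x₁, …, x_m)` and outputs `Y = (y₁, …, y_n)`. -/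
abbrev Spec (m n : ℕ) := Formula (Fin m ⊕ Fin n)

/-! ### The specification with strict inequalities, and its elimination formula -/

variable {m n : ℕ}

/-- The polynomial `p(X, y)` contains the output variable `y`. -/
def HasOutput (p : MvPolynomial (Fin m ⊕ Fin 1) ℚ) : Prop := Sum.inr 0 ∈ p.vars

/-- The polynomials containing `y` that occur in non-strict inequalities of `φ`
(written without negations). -/
def nonStrict (φ : Spec m 1) : List (MvPolynomial (Fin m ⊕ Fin 1) ℚ) :=
  (φ.nnf.atoms.filter fun a => decide (HasOutput a.1 ∧ a.2.IsNonStrict)).map Prod.fst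

/-- `φ̂`: in `φ` (written without negations), every non-strict inequality whose polynomial
contains `y` is replaced by the corresponding strict one. -/
def hat (φ : Spec m 1) : Spec m 1 :=
  φ.nnf.bind fun p r => Formula.atom p (if HasOutput p then r.strict else r)

/-- The quantifier-free formula `ψ(X)` is equivalent over the reals to `∃ y, χ(X, y)`. -/
def IsElim (ψ : Formula (Fin m)) (χ : Spec m 1) : Prop :=
  ∀ A : Fin m → ℝ, ψ.Holds A ↔ ∃ y : ℝ, χ.Holds (Sum.elim A fun _ => y)

/-! ### The two modules called by the synthesized program -/

/-- The univariate polynomial `p(A, y)` obtained by substituting the inputs `A` for `X`. -/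
def specialize (A : Fin m → ℚ) (p : MvPolynomial (Fin m ⊕ Fin 1) ℚ) : Polynomial ℚ :=
  MvPolynomial.aeval (Sum.elim (fun i => Polynomial.C (A i)) fun _ => Polynomial.X) p

/-- The lists of positive factors of a natural number (empty for `0`). -/
def factors (k : ℕ) : List ℕ := (List.range (k + 1)).filter fun d => decide (0 < k ∧ d ∣ k)

/-- The least common multiple of the denominators of the coefficients. -/
def denomLcm (q : Polynomial ℚ) : ℕ := q.support.lcm fun i => (q.coeff i).den

/-- Candidate rational roots of `q = 0`. Denominators are cleared, a power of the variable is
split off (which contributes the candidate `0`), and then the candidates are all `± u / v` with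
`u` a factor of the lowest and `v` a factor of the highest coefficient. -/
def candRatRoot (q : Polynomial ℚ) : List ℚ :=
  let a₀ : ℕ := ((denomLcm q : ℚ) * q.trailingCoeff).num.natAbs
  let aₙ : ℕ := ((denomLcm q : ℚ) * q.leadingCoeff).num.natAbs
  (if q.natTrailingDegree = 0 then [] else [0]) ++
    (factors a₀).flatMap fun u => (factors aₙ).flatMap fun v =>
      [(u : ℚ) / (v : ℚ), -((u : ℚ) / (v : ℚ))]

/-- `∑ᵢ |aᵢ| Bⁱ`, an upper bound for `|q|` on `[-B, B]`. -/
def absBound (q : Polynomial ℚ) (B : ℚ) : ℚ := q.sum fun i a => |a| * B ^ i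

/-- A bound such that all real roots of `q ≠ 0` lie in `(-B, B)`. -/
def rootBound (q : Polynomial ℚ) : ℚ := 1 + q.sum fun _ a => |a / q.leadingCoeff|

/-- The square-free part of `q`. -/
def squarefreePart (q : Polynomial ℚ) : Polynomial ℚ :=
  q / EuclideanDomain.gcd q (Polynomial.derivative q)

/-- Number of cells of the isolating grid for a square-free `s`. With `u s + v s' = c`, a
non-zero constant, distinct real roots of `s` are at distance at least
`|c| / (max |v| * max |s''|)`, and the cells are at most a quarter as long. -/
def gridSize (s : Polynomial ℚ) : ℕ :=
  let s' := Polynomial.derivative s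
  let B := rootBound s
  let c := (EuclideanDomain.gcd s s').coeff 0
  ⌈8 * B * absBound (EuclideanDomain.gcdB s s') B *
      absBound (Polynomial.derivative s') B / |c|⌉₊ + 1

/-- Real root isolation for `q ≠ 0`: an increasing list of disjoint open intervals with rational
end points, each of which contains exactly one real root of `q`, and which cover all real roots.
The square-free part has a root in the grid cell `[g, g + h)` iff it vanishes at `g` or changes
sign between `g` and `g + h`; the interval returned for such a cell is `(g - h, g + h)`. -/
def isolateRoots (q : Polynomial ℚ) : List (ℚ × ℚ) :=
  let s := squarefreePart q
  let B := rootBound s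
  let h : ℚ := 2 * B / (gridSize s : ℚ)
  (List.range (gridSize s)).filterMap fun k =>
    let g : ℚ := -B + (k : ℚ) * h
    if s.eval g = 0 ∨ s.eval g * s.eval (g + h) < 0 then some (g - h, g + h) else none

/-- The mid-points of the gaps between successive intervals, and `u + 1` for the last end point
`u`. -/
def gapPoints : List (ℚ × ℚ) → List ℚ
  | [] => []
  | [I] => [I.2 + 1]
  | I :: J :: L => (I.2 + J.1) / 2 :: gapPoints (J :: L)

/-- The sample points of a list of isolating intervals `(l₁, u₁), …, (l_k, u_k)`:
`l₁ - 1, (u₁ + l₂) / 2, …, (u_{k-1} + l_k) / 2, u_k + 1`, and the point `0` if `k = 0`. -/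
def samplePoints : List (ℚ × ℚ) → List ℚ
  | [] => [0]
  | I :: L => (I.1 - 1) :: gapPoints (I :: L)

/-- Rational sample points for `χ(A, y)`: real roots are isolated for the product of those
polynomials of `χ(A, y)` that are not identically zero. -/
def rationalSamples (χ : Spec m 1) (A : Fin m → ℚ) : List ℚ :=
  samplePoints (isolateRoots
    (((χ.atoms.map fun a => specialize A a.1).filter fun q => decide (q ≠ 0)).prod))

/-! ### Programs -/

/-- Program variables: the inputs (which a program cannot assign to) and local variables. -/
abbrev PVar (m : ℕ) := Fin m ⊕ ℕ

/-- Calls of the two modules; they are evaluated at the current values of the inputs. -/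
inductive Call (m : ℕ)
  | rationalSamples (χ : Spec m 1)
  | candRatRoot (p : MvPolynomial (Fin m ⊕ Fin 1) ℚ)

/-- The list of rationals returned by a call. -/
def Call.eval (A : Fin m → ℚ) : Call m → List ℚ
  | .rationalSamples χ => NRA.rationalSamples χ A
  | .candRatRoot p => NRA.candRatRoot (specialize A p)

/-- Imperative programs over the rationals with `m` inputs and `n` outputs: assignments of
polynomial terms, conditionals and loops guarded by polynomial constraints, return of a tuple of
variables or of `⊥`, sequencing, and `for all z in C do P` for a module call `C`. -/
inductive Prog (m n : ℕ)
  | assign (z : ℕ) (t : MvPolynomial (PVar m) ℚ)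
  | cond (g : Formula (PVar m)) (P Q : Prog m n)
  | loop (g : Formula (PVar m)) (P : Prog m n)
  | ret (t : Fin n → PVar m)
  | retBot
  | seq (P Q : Prog m n)
  | forAll (z : ℕ) (C : Call m) (P : Prog m n)

/-- Result of executing a statement: control passes on with a new store, or the program returns
a tuple or `⊥` (`none`). -/
inductive Outcome (m n : ℕ)
  | next (σ : PVar m → ℚ)
  | returned (b : Option (Fin n → ℚ))

/-- Run `k` after a statement, unless that statement has returned. -/
def andThen (o : Option (Outcome m n)) (k : (PVar m → ℚ) → Option (Outcome m n)) :
    Option (Outcome m n) :=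
  match o with
  | none => none
  | some (Outcome.returned b) => some (Outcome.returned b)
  | some (Outcome.next σ) => k σ

/-- A while loop with a bound on the number of tests of its guard; `none` if this is too
small. -/
def runLoop (g : Formula (PVar m)) (body : (PVar m → ℚ) → Option (Outcome m n)) :
    ℕ → (PVar m → ℚ) → Option (Outcome m n)
  | 0, _ => none
  | k + 1, σ =>
    if g.Holds σ then andThen (body σ) (runLoop g body k) else some (Outcome.next σ)

/-- A loop over a finite list of values of the local variable `z`. -/
def runForAll (z : ℕ) (body : (PVar m → ℚ) → Option (Outcome m n)) :
    List ℚ → (PVar m → ℚ) → Option (Outcome m n)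
  | [], σ => some (Outcome.next σ)
  | a :: L, σ =>
    andThen (body (Function.update σ (Sum.inr z) a)) (runForAll z body L)

/-- Execution of a program from a store, where each while loop may test its guard at most `k`
times; `none` if this is too small. -/
def Prog.run (k : ℕ) : Prog m n → (PVar m → ℚ) → Option (Outcome m n)
  | .assign z t, σ => some (.next (Function.update σ (Sum.inr z) (MvPolynomial.eval σ t)))
  | .cond g P Q, σ => if g.Holds σ then P.run k σ else Q.run k σ
  | .loop g P, σ => runLoop g (P.run k) k σ
  | .ret t, σ => some (.returned (some fun j => σ (t j)))
  | .retBot, _ => some (.returned none)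
  | .seq P Q, σ => andThen (P.run k σ) (Q.run k)
  | .forAll z C P, σ => runForAll z (P.run k) (C.eval fun i => σ (Sum.inl i)) σ

/-- Run on the input `A` (local variables are initially `0`), the program terminates and
returns `b`. -/
def Prog.Returns (P : Prog m n) (A : Fin m → ℚ) (b : Option (Fin n → ℚ)) : Prop :=
  ∃ k : ℕ, P.run k (Sum.elim A fun _ => 0) = some (.returned b)

/-- On the input `A` the program terminates with a result, and whenever this is a tuple `B` of
rationals, `φ(A, B)` holds. -/
def Prog.SoundAt (P : Prog m n) (φ : Spec m n) (A : Fin m → ℚ) : Prop :=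
  (∃ b, P.Returns A b) ∧
    ∀ B : Fin n → ℚ, P.Returns A (some B) → φ.Holds (Sum.elim A B)

/-- On the input `A` the program terminates and returns a rational `B` with `φ(A, B)`, or `⊥`,
the latter exactly if there is no such rational `B`. -/
def Prog.RealizesAt (P : Prog m n) (φ : Spec m n) (A : Fin m → ℚ) : Prop :=
  P.SoundAt φ A ∧
    (P.Returns A none ↔ ∀ B : Fin n → ℚ, ¬ φ.Holds (Sum.elim A B))

/-- The program realizes the specification `φ` over the rationals. -/
def Prog.Realizes (P : Prog m n) (φ : Spec m n) : Prop :=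
  ∀ A : Fin m → ℚ, P.RealizesAt φ A

/-! ### The synthesized program for a single output -/

/-- A statement without effect. -/
def Prog.skip : Prog m n := .assign 0 (MvPolynomial.X (Sum.inr 0))

/-- `for all z in C do if χ(X, z) then return z`. -/
def Prog.tryAll (C : Call m) (χ : Spec m 1) : Prog m 1 :=
  .forAll 0 C
    (.cond (χ.rename (Sum.map id fun _ => 0)) (.ret fun _ => Sum.inr 0) .skip)

/-- The program synthesized from `φ(X, y)` and a formula `ψ(X)`, which has to be equivalent to
`∃ y, φ̂(X, y)`. -/
def progOne (φ : Spec m 1) (ψ : Formula (Fin m)) : Prog m 1 :=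
  .cond (ψ.rename Sum.inl)
    (.tryAll (.rationalSamples (hat φ)) (hat φ))
    ((nonStrict φ).foldr (fun p Q => .seq (.tryAll (.candRatRoot p) φ) Q) .retBot)

/-! ### Inputs at which a polynomial vanishes identically -/

/-- No polynomial of a non-strict inequality of `φ` that contains `y` becomes the zero polynomial
in `y` when the inputs `A` are substituted. -/
def NonDegenerateAt (φ : Spec m 1) (A : Fin m → ℚ) : Prop :=
  ∀ p ∈ nonStrict φ, specialize A p ≠ 0

/-- `p(X, y)` as a polynomial in `y` whose coefficients are polynomials in `X`. -/
def asPolyInOutput (p : MvPolynomial (Fin m ⊕ Fin 1) ℚ) : Polynomial (MvPolynomial (Fin m) ℚ) :=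
  MvPolynomial.aeval
    (Sum.elim (fun i => Polynomial.C (MvPolynomial.X i)) fun _ => Polynomial.X) p

/-- The formula in `X` stating that all coefficients `c₀(X), …, c_d(X)` of `p(X, y)` as a
polynomial in `y` are zero. -/
def vanishes (p : MvPolynomial (Fin m ⊕ Fin 1) ℚ) : Spec m 1 :=
  (List.range ((asPolyInOutput p).natDegree + 1)).foldr
    (fun i f =>
      .and (.eqZero (MvPolynomial.rename Sum.inl ((asPolyInOutput p).coeff i))) f)
    .tru

/-- The specification equivalent to `φ` in which (written without negations) each non-strict
inequality `p ⋈ 0` whose polynomial contains `y` is replaced by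
`p ⋈ 0 ∨ (c₀(X) = 0 ∧ … ∧ c_d(X) = 0)`, where `p = c₀(X) + c₁(X) y + ⋯ + c_d(X) y ^ d`. -/
def expand (φ : Spec m 1) : Spec m 1 :=
  φ.nnf.bind fun p r =>
    if HasOutput p ∧ r.IsNonStrict then .or (.atom p r) (vanishes p) else .atom p r

end NRA

end

/-!
The program tests `ψ` first and so splits the inputs according to whether the strict version
`hat φ` can be satisfied by a real output.

If it can, then the set of all outputs that satisfy `hat φ` is open, since the atoms of `hat φ`
are strict or independent of the output (`isOpen_holds_hat`). It therefore contains a point that is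
not a root of any of the specialized polynomials, and truth does not change on the component of
that point in the complement of the roots. The sample points meet every such component
(`exists_mem_samplePoints`), provided that root isolation is correct (`isolateRoots_spec`). The
latter rests on two facts: roots of `q` are simple roots of `q / gcd(q, q')`, hence seen as zeros or
sign changes on a fine grid; and the grid is fine, since Rolle's theorem and a Bézout identity
`u s + v s' = c` bound the distance of two roots below (`four_mul_cell_lt`).

If it cannot, then a rational solution of `φ` must be a zero of the polynomial of a non-strict
inequality. If this polynomial does not vanish identically at the input, the zero is among the
candidates by the rational root theorem (`mem_candRatRoot`). In the expansion of `φ`, identically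
vanishing polynomials do no harm: the added disjunct makes their atoms true in the strict version
as well (`rootsCoverAt_expand`).

The formulas `ψ` come from an elimination theorem for one real quantifier, in the manner of Cohen
and Hörmander but without an explicit algorithm. Two parameter points `A` and `B` have the same
diagram for a finite list of polynomials in `y` if an order automorphism of the line carries the
signs of the polynomials at `A` to those at `B`; then `∃ y, χ` has the same truth value at `A` and
`B`. By induction on the multiset of degrees, in the Dershowitz–Manna order, the diagram is
determined by the signs of finitely many polynomials in the parameters
(`exists_sameSigns_imp_sameDiagram`): a polynomial of highest degree can be traded for its
derivative and its pseudo-remainders modulo the other polynomials. The analytic content of this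
step is `exists_orderIso_of_derivative`, which corrects an automorphism that is right for the
derivative, by moving single points inside the gaps between the known roots. A set of parameters
that is determined by finitely many signs is described by a finite disjunction of sign conditions
(`exists_formula_of_sameSigns`).
-/

noncomputable section

namespace NRA

open scoped Classical

open Polynomial

/-! ### Truth of formulas -/

variable {V W : Type}

lemma Rel.holds_congr_sign {K L : Type*} [Zero K] [LinearOrder K] [Zero L] [LinearOrder L]
    (r : Rel) {a : K} {b : L} (h : SignType.sign a = SignType.sign b) :
    r.Holds a ↔ r.Holds b := by
  have hneg : a < 0 ↔ b < 0 := by rw [← sign_eq_neg_one_iff, h, sign_eq_neg_one_iff]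
  have hpos : 0 < a ↔ 0 < b := by rw [← sign_eq_one_iff, h, sign_eq_one_iff]
  cases r with
  | lt => exact hneg
  | gt => exact hpos
  | le => simpa [Rel.Holds, not_lt] using not_congr hpos
  | ge => simpa [Rel.Holds, not_lt] using not_congr hneg

lemma Rel.holds_neg {K : Type*} [Zero K] [LinearOrder K] (r : Rel) (a : K) :
    r.neg.Holds a ↔ ¬ r.Holds a := by
  cases r <;> simp [Rel.neg, Rel.Holds]

lemma Rel.Holds.of_strict {K : Type*} [Zero K] [LinearOrder K] {r : Rel} {a : K}
    (h : r.strict.Holds a) : r.Holds a := by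
  cases r <;> simp only [Rel.strict, Rel.Holds] at * <;> first | exact h | exact h.le

lemma Rel.Holds.strict {K : Type*} [Zero K] [LinearOrder K] {r : Rel} {a : K}
    (h : r.Holds a) (ha : r.IsNonStrict → a ≠ 0) : r.strict.Holds a := by
  cases r with
  | lt => exact h
  | gt => exact h
  | le => exact lt_of_le_of_ne h (ha trivial)
  | ge => exact lt_of_le_of_ne h (ha trivial).symm

lemma Rel.IsNonStrict.holds_zero {K : Type*} [Zero K] [LinearOrder K] {r : Rel}
    (h : r.IsNonStrict) : r.Holds (0 : K) := by
  cases r <;> simp_all [Rel.IsNonStrict, Rel.Holds]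

lemma Rel.isOpen_strict (r : Rel) : IsOpen {a : ℝ | r.strict.Holds a} := by
  cases r
  · exact isOpen_Iio
  · exact isOpen_Ioi
  · exact isOpen_Iio
  · exact isOpen_Ioi

namespace Formula

section

variable {K : Type*} [Field K] [LinearOrder K] [Algebra ℚ K]
variable {L : Type*} [Field L] [LinearOrder L] [Algebra ℚ L]

/-- Truth of a formula depends only on the signs of its polynomials. -/
lemma holds_congr_sign (f : Formula V) (v : V → K) (w : V → L)
    (h : ∀ a ∈ f.atoms, SignType.sign (MvPolynomial.aeval v a.1) =
      SignType.sign (MvPolynomial.aeval w a.1)) : f.Holds v ↔ f.Holds w := by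
  induction f with
  | atom p r => exact r.holds_congr_sign (h (p, r) (by simp [atoms]))
  | not f ih => exact not_congr (ih h)
  | and f g ihf ihg =>
    simp only [atoms, List.mem_append] at h
    exact and_congr (ihf fun a ha => h a (.inl ha)) (ihg fun a ha => h a (.inr ha))
  | or f g ihf ihg =>
    simp only [atoms, List.mem_append] at h
    exact or_congr (ihf fun a ha => h a (.inl ha)) (ihg fun a ha => h a (.inr ha))

lemma holds_cast (f : Formula V) (v : V → ℚ) :
    f.Holds (fun i => (v i : ℝ)) ↔ f.Holds v := by
  refine f.holds_congr_sign _ _ fun a _ => ?_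
  have h : MvPolynomial.aeval (fun i => (v i : ℝ)) a.1 =
      ((MvPolynomial.aeval v a.1 : ℚ) : ℝ) := by
    exact MvPolynomial.aeval_algebraMap_apply ℝ v a.1
  rw [h]
  rcases lt_trichotomy (MvPolynomial.aeval v a.1 : ℚ) 0 with h0 | h0 | h0
  · rw [sign_neg h0, sign_neg (by exact_mod_cast h0)]
  · simp [h0]
  · rw [sign_pos h0, sign_pos (by exact_mod_cast h0)]

lemma holds_rename (f : Formula V) (e : V → W) (w : W → K) :
    (f.rename e).Holds w ↔ f.Holds (w ∘ e) := by
  induction f with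
  | atom p r => simp [rename, bind, Holds, MvPolynomial.aeval_rename]
  | not f ih => exact not_congr ih
  | and f g ihf ihg => exact and_congr ihf ihg
  | or f g ihf ihg => exact or_congr ihf ihg

lemma holds_eqZero (p : MvPolynomial V ℚ) (v : V → K) :
    (eqZero p).Holds v ↔ MvPolynomial.aeval v p = 0 := by
  simp only [eqZero, Holds, Rel.Holds]
  exact ⟨fun h => le_antisymm h.1 h.2, fun h => ⟨h.le, h.ge⟩⟩

lemma holds_tru (v : V → K) : (tru : Formula V).Holds v := by
  simp [tru, Holds, Rel.Holds]

end

/-- No negation occurs in the formula. -/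
def IsNegFree : Formula V → Prop
  | atom _ _ => True
  | not _ => False
  | and f g => f.IsNegFree ∧ g.IsNegFree
  | or f g => f.IsNegFree ∧ g.IsNegFree

lemma isNegFree_nnfAux (f : Formula V) : ∀ b, (nnfAux b f).IsNegFree := by
  induction f with
  | atom p r => rintro (_ | _) <;> simp [nnfAux, IsNegFree]
  | not f ih => rintro (_ | _) <;> simpa [nnfAux] using ih _
  | and f g ihf ihg => rintro (_ | _) <;> simp [nnfAux, IsNegFree, ihf, ihg]
  | or f g ihf ihg => rintro (_ | _) <;> simp [nnfAux, IsNegFree, ihf, ihg]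

lemma isNegFree_nnf (f : Formula V) : f.nnf.IsNegFree := isNegFree_nnfAux f true

lemma IsNegFree.nnf_eq {f : Formula V} (h : f.IsNegFree) : f.nnf = f := by
  induction f with
  | atom p r => rfl
  | not f ih => exact h.elim
  | and f g ihf ihg => exact congrArg₂ and (ihf h.1) (ihg h.2)
  | or f g ihf ihg => exact congrArg₂ or (ihf h.1) (ihg h.2)

lemma IsNegFree.bind {f : Formula V} (h : f.IsNegFree) {s : MvPolynomial V ℚ → Rel → Formula W}
    (hs : ∀ p r, (s p r).IsNegFree) : (f.bind s).IsNegFree := by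
  induction f with
  | atom p r => exact hs p r
  | not f ih => exact h.elim
  | and f g ihf ihg => exact ⟨ihf h.1, ihg h.2⟩
  | or f g ihf ihg => exact ⟨ihf h.1, ihg h.2⟩

lemma holds_nnfAux {K : Type*} [Field K] [LinearOrder K] [Algebra ℚ K] (f : Formula V)
    (v : V → K) : ((nnfAux true f).Holds v ↔ f.Holds v) ∧
      ((nnfAux false f).Holds v ↔ ¬ f.Holds v) := by
  induction f with
  | atom p r => exact ⟨Iff.rfl, r.holds_neg _⟩
  | not f ih => exact ⟨ih.2, by simpa [nnfAux, Holds] using ih.1⟩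
  | and f g ihf ihg =>
    refine ⟨and_congr ihf.1 ihg.1, ?_⟩
    simp only [nnfAux, Holds, ihf.2, ihg.2]
    tauto
  | or f g ihf ihg =>
    refine ⟨or_congr ihf.1 ihg.1, ?_⟩
    simp only [nnfAux, Holds, ihf.2, ihg.2]
    tauto

lemma holds_nnf {K : Type*} [Field K] [LinearOrder K] [Algebra ℚ K] (f : Formula V)
    (v : V → K) : f.nnf.Holds v ↔ f.Holds v := (holds_nnfAux f v).1

lemma bind_atom (f : Formula V) : f.bind atom = f := by
  induction f with
  | atom p r => rfl
  | not f ih => exact congrArg not ih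
  | and f g ihf ihg => exact congrArg₂ and ihf ihg
  | or f g ihf ihg => exact congrArg₂ or ihf ihg

/-- In a negation-free formula, weakening the atoms weakens the formula. -/
lemma IsNegFree.holds_bind_mono {f : Formula V} (h : f.IsNegFree)
    {K L : Type*} [CommRing K] [LinearOrder K] [Algebra ℚ K]
    [CommRing L] [LinearOrder L] [Algebra ℚ L] {W' : Type}
    {s : MvPolynomial V ℚ → Rel → Formula W} {t : MvPolynomial V ℚ → Rel → Formula W'}
    {v : W → K} {w : W' → L}
    (hst : ∀ p r, (p, r) ∈ f.atoms → (s p r).Holds v → (t p r).Holds w) :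
    (f.bind s).Holds v → (f.bind t).Holds w := by
  induction f with
  | atom p r => exact hst p r (by simp [atoms])
  | not f ih => exact h.elim
  | and f g ihf ihg =>
    simp only [atoms, List.mem_append] at hst
    exact And.imp (ihf h.1 fun p r hp => hst p r (.inl hp))
      (ihg h.2 fun p r hp => hst p r (.inr hp))
  | or f g ihf ihg =>
    simp only [atoms, List.mem_append] at hst
    exact Or.imp (ihf h.1 fun p r hp => hst p r (.inl hp))
      (ihg h.2 fun p r hp => hst p r (.inr hp))

lemma bind_bind {U : Type} (f : Formula V) (s : MvPolynomial V ℚ → Rel → Formula W)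
    (t : MvPolynomial W ℚ → Rel → Formula U) :
    (f.bind s).bind t = f.bind fun p r => (s p r).bind t := by
  induction f with
  | atom p r => rfl
  | not f ih => exact congrArg not ih
  | and f g ihf ihg => exact congrArg₂ and ihf ihg
  | or f g ihf ihg => exact congrArg₂ or ihf ihg

lemma atoms_bind (f : Formula V) (s : MvPolynomial V ℚ → Rel → Formula W)
    (a : MvPolynomial W ℚ × Rel) :
    a ∈ (f.bind s).atoms ↔ ∃ b ∈ f.atoms, a ∈ (s b.1 b.2).atoms := by
  induction f with
  | atom p r => simp [bind, atoms]
  | not f ih => exact ih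
  | and f g ihf ihg => simp [bind, atoms, ihf, ihg, or_and_right, exists_or]
  | or f g ihf ihg => simp [bind, atoms, ihf, ihg, or_and_right, exists_or]

end Formula

/-! ### Polynomials in the output variable -/

variable {m : ℕ}

lemma eval_map_asPolyInOutput (p : MvPolynomial (Fin m ⊕ Fin 1) ℚ) (A : Fin m → ℝ) (y : ℝ) :
    ((asPolyInOutput p).map
      (MvPolynomial.aeval A : MvPolynomial (Fin m) ℚ →ₐ[ℚ] ℝ).toRingHom).eval y = MvPolynomial.aeval (Sum.elim A fun _ => y) p := by
  unfold asPolyInOutput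
  induction p using MvPolynomial.induction_on with
  | C a =>
    simp only [MvPolynomial.aeval_C]
    rw [IsScalarTower.algebraMap_apply ℚ (MvPolynomial (Fin m) ℚ)
      (Polynomial (MvPolynomial (Fin m) ℚ)) a]
    simp
  | add p q hp hq => simp only [map_add, Polynomial.map_add, Polynomial.eval_add, hp, hq]
  | mul_X p i hp =>
    rw [map_mul, Polynomial.map_mul, Polynomial.eval_mul, hp, map_mul]
    rcases i with i | i <;> simp

lemma aeval_specialize (p : MvPolynomial (Fin m ⊕ Fin 1) ℚ) (A : Fin m → ℚ) (y : ℝ) :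
    Polynomial.aeval y (specialize A p) =
      MvPolynomial.aeval (Sum.elim (fun i => (A i : ℝ)) fun _ => y) p := by
  unfold specialize
  induction p using MvPolynomial.induction_on with
  | C a => simp
  | add p q hp hq => simp only [map_add, hp, hq]
  | mul_X p i hp =>
    rw [map_mul, map_mul, hp, map_mul]
    rcases i with i | i <;> simp

/-- A polynomial that does not contain the output variable is constant in it. -/
lemma aeval_eq_of_not_hasOutput {p : MvPolynomial (Fin m ⊕ Fin 1) ℚ} (hp : ¬ HasOutput p)
    (A : Fin m → ℝ) (y z : ℝ) :
    MvPolynomial.aeval (Sum.elim A fun _ => y) p =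
      MvPolynomial.aeval (Sum.elim A fun _ => z) p := by
  refine MvPolynomial.eval₂Hom_congr' rfl ?_ rfl
  rintro (i | i) hi -
  · rfl
  · obtain rfl : i = 0 := Subsingleton.elim _ _
    exact (hp hi).elim

/-! ### Order automorphisms of the line that match the roots of two polynomials -/

/-- Two points of an interval can be moved into each other by an order automorphism of the line
that is the identity outside the interval. -/
lemma exists_orderIso_move {a b x y : ℝ} (hax : a < x) (hxb : x < b) (hay : a < y) (hyb : y < b) :
    ∃ g : ℝ ≃o ℝ, g x = y ∧ ∀ t, t ∉ Set.Ioo a b → g t = t := by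
  wlog hxy : x ≤ y generalizing x y
  · obtain ⟨g, h1, h2⟩ := this hay hyb hax hxb (le_of_not_ge hxy)
    refine ⟨g.symm, by rw [← h1, g.symm_apply_apply], fun t ht => ?_⟩
    rw [g.symm_apply_eq, h2 t ht]
  -- the identity plus a multiple of the piecewise linear bump with support `[a, b]` and peak `x`
  let tent : ℝ → ℝ := fun t => max 0 (min ((t - a) / (x - a)) ((b - t) / (b - x)))
  let g : ℝ → ℝ := fun t => t + (y - x) * tent t
  have hxa' : 0 < x - a := sub_pos.2 hax
  have hbx' : 0 < b - x := sub_pos.2 hxb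
  have hout : ∀ t, t ∉ Set.Ioo a b → g t = t := by
    intro t ht
    have : tent t = 0 := by
      refine max_eq_left ?_
      by_cases h : a < t
      · have : b ≤ t := not_lt.1 fun h' => ht ⟨h, h'⟩
        exact (min_le_right _ _).trans (div_nonpos_of_nonpos_of_nonneg (by linarith) hbx'.le)
      · exact (min_le_left _ _).trans (div_nonpos_of_nonpos_of_nonneg (by linarith) hxa'.le)
    simp [g, this]
  have hgx : g x = y := by
    have : tent x = 1 := by simp [tent, div_self hxa'.ne', div_self hbx'.ne']
    simp [g, this]
  have hmono : StrictMono g := by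
    intro s t hst
    have h1 : tent s ≤ tent t + (t - s) / (b - x) := by
      have h0 : 0 < (t - s) / (b - x) := div_pos (sub_pos.2 hst) hbx'
      refine max_le (add_nonneg (le_max_left _ _) h0.le) ?_
      have h2 : min ((s - a) / (x - a)) ((b - s) / (b - x)) ≤
          min ((t - a) / (x - a)) ((b - t) / (b - x)) + (t - s) / (b - x) := by
        rw [← min_add_add_right]
        refine min_le_min ?_ ?_
        · have : (s - a) / (x - a) ≤ (t - a) / (x - a) := by gcongr
          linarith
        · rw [← add_div]
          exact (congrArg (· / (b - x)) (by ring)).le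
      exact h2.trans (by gcongr; exact le_max_right _ _)
    have h3 : (y - x) * tent s ≤ (y - x) * (tent t + (t - s) / (b - x)) :=
      mul_le_mul_of_nonneg_left h1 (sub_nonneg.2 hxy)
    have h4 : (y - x) * ((t - s) / (b - x)) < t - s := by
      rw [← mul_div_assoc, div_lt_iff₀ hbx', mul_comm]
      exact mul_lt_mul_of_pos_left (by linarith) (sub_pos.2 hst)
    simp only [g]
    linarith [mul_add (y - x) (tent t) ((t - s) / (b - x))]
  have hsurj : Function.Surjective g := by
    intro w
    by_cases hw : w ∈ Set.Ioo a b
    · have hc : Continuous g := by fun_prop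
      have hab : a ≤ b := (hax.trans hxb).le
      have := intermediate_value_Icc hab hc.continuousOn
      rw [hout a (by simp), hout b (by simp)] at this
      obtain ⟨t, -, ht⟩ := this ⟨hw.1.le, hw.2.le⟩
      exact ⟨t, ht⟩
    · exact ⟨w, hout w hw⟩
  exact ⟨hmono.orderIsoOfSurjective g hsurj, hgx, hout⟩

lemma sign_eq_of_ne_zero_on_uIcc {F : ℝ → ℝ} (hF : Continuous F) {a b : ℝ}
    (h0 : ∀ t ∈ Set.uIcc a b, F t ≠ 0) : SignType.sign (F a) = SignType.sign (F b) := by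
  have key : ¬ (0 : ℝ) ∈ Set.uIcc (F a) (F b) := fun h => by
    obtain ⟨s, hs, hs0⟩ := intermediate_value_uIcc hF.continuousOn h
    exact h0 s hs hs0
  rw [Set.mem_uIcc] at key
  rcases lt_or_gt_of_ne (h0 a Set.left_mem_uIcc) with h1 | h1 <;>
    rcases lt_or_gt_of_ne (h0 b Set.right_mem_uIcc) with h2 | h2
  · rw [sign_neg h1, sign_neg h2]
  · exact (key (.inl ⟨h1.le, h2.le⟩)).elim
  · exact (key (.inr ⟨h2.le, h1.le⟩)).elim
  · rw [sign_pos h1, sign_pos h2]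

/-- The points `y` and `t` lie outside the finite set `Z` and in the same component of its
complement. -/
def SameGap (Z : Finset ℝ) (y t : ℝ) : Prop := ∀ z ∈ Z, (z < y ∧ z < t) ∨ (y < z ∧ t < z)

namespace SameGap

variable {Z : Finset ℝ} {x y t : ℝ}

lemma refl (h : y ∉ Z) : SameGap Z y y := fun z hz => by
  rcases lt_trichotomy z y with h1 | h1 | h1
  · exact .inl ⟨h1, h1⟩
  · exact (h (h1 ▸ hz)).elim
  · exact .inr ⟨h1, h1⟩

lemma symm (h : SameGap Z y t) : SameGap Z t y := fun z hz => (h z hz).imp And.symm And.symm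

lemma trans (h : SameGap Z x y) (h' : SameGap Z y t) : SameGap Z x t := fun z hz => by
  rcases h z hz with h1 | h1 <;> rcases h' z hz with h2 | h2
  · exact .inl ⟨h1.1, h2.2⟩
  · exact (h1.2.trans h2.1).false.elim
  · exact (h1.2.trans h2.1).false.elim
  · exact .inr ⟨h1.1, h2.2⟩

lemma right_notMem (h : SameGap Z y t) : t ∉ Z := fun ht => by
  rcases h t ht with h1 | h1
  · exact h1.2.false
  · exact h1.2.false

lemma of_between {s : ℝ} (h : SameGap Z y t) (hy : y ≤ s) (ht : s ≤ t) : SameGap Z y s :=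
  fun z hz => by
  rcases h z hz with h1 | h1
  · exact .inl ⟨h1.1, h1.1.trans_le hy⟩
  · exact .inr ⟨h1.1, ht.trans_lt h1.2⟩

lemma of_mem_uIcc {s : ℝ} (h : SameGap Z y t) (hs : s ∈ Set.uIcc y t) : SameGap Z y s :=
  fun z hz => by
  rw [Set.mem_uIcc] at hs
  rcases h z hz with h1 | h1
  · exact .inl ⟨h1.1, by rcases hs with hs | hs; exacts [h1.1.trans_le hs.1, h1.2.trans_le hs.1]⟩
  · exact .inr ⟨h1.1, by rcases hs with hs | hs; exacts [hs.2.trans_lt h1.2, hs.2.trans_lt h1.1]⟩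

lemma isOpen (Z : Finset ℝ) (y : ℝ) : IsOpen {t | SameGap Z y t} := by
  have : {t | SameGap Z y t} = ⋂ z ∈ Z, {t | (z < y ∧ z < t) ∨ (y < z ∧ t < z)} := by
    ext t; simp [SameGap]
  rw [this]
  refine isOpen_biInter_finset fun z _ => ?_
  exact (isOpen_const.inter isOpen_Ioi).union (isOpen_const.inter isOpen_Iio)

lemma map (h : SameGap Z y t) (g : ℝ ≃o ℝ) : SameGap (Z.image g) (g y) (g t) := by
  intro z hz
  obtain ⟨w, hw, rfl⟩ := Finset.mem_image.1 hz
  simpa using h w hw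

lemma of_map (g : ℝ ≃o ℝ) (h : SameGap (Z.image g) (g y) (g t)) : SameGap Z y t := by
  intro z hz
  simpa using h (g z) (Finset.mem_image_of_mem g hz)

/-- An order automorphism that fixes `Z` preserves the gaps of `Z`. -/
lemma apply_of_fix {g : ℝ ≃o ℝ} (hg : ∀ z ∈ Z, g z = z) (h : y ∉ Z) : SameGap Z y (g y) := by
  intro z hz
  have := refl h z hz
  rcases this with h1 | h1
  · exact .inl ⟨h1.1, by rw [← hg z hz]; exact g.strictMono h1.1⟩
  · exact .inr ⟨h1.1, by rw [← hg z hz]; exact g.strictMono h1.1⟩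

/-- A continuous function without zeros on a gap has constant sign there. -/
lemma sign_eq {F : ℝ → ℝ} (hF : Continuous F) (h0 : ∀ t, SameGap Z y t → F t ≠ 0)
    (h : SameGap Z y t) : SignType.sign (F y) = SignType.sign (F t) :=
  sign_eq_of_ne_zero_on_uIcc hF fun _ hs => h0 _ (h.of_mem_uIcc hs)

end SameGap

/-- Matching of two functions that are strictly monotone, in the same direction, on the gaps of
a finite set `Z`. The automorphism is adjusted at one zero of `F` after the other. -/
lemma exists_orderIso_sign_eq {F G : ℝ → ℝ} (hF : Continuous F) (hG : Continuous G)
    {Z R : Finset ℝ} (hR : ∀ y, F y = 0 → y ∈ R)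
    (hZ : ∀ z ∈ Z, SignType.sign (F z) = SignType.sign (G z))
    (hmono : ∀ y, y ∉ Z →
      (StrictMonoOn F {t | SameGap Z y t} ∧ StrictMonoOn G {t | SameGap Z y t}) ∨
      (StrictAntiOn F {t | SameGap Z y t} ∧ StrictAntiOn G {t | SameGap Z y t}))
    (hpos : ∀ y, y ∉ Z → ((∀ t, SameGap Z y t → 0 < F t) ↔ ∀ t, SameGap Z y t → 0 < G t))
    (hneg : ∀ y, y ∉ Z → ((∀ t, SameGap Z y t → F t < 0) ↔ ∀ t, SameGap Z y t → G t < 0)) :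
    ∃ g : ℝ ≃o ℝ, (∀ z ∈ Z, g z = z) ∧
      ∀ y, SignType.sign (F y) = SignType.sign (G (g y)) := by
  have const : ∀ {F : ℝ → ℝ}, Continuous F → ∀ {y}, y ∉ Z →
      (∀ t, SameGap Z y t → F t ≠ 0) →
      (∀ t, SameGap Z y t → 0 < F t) ∨ (∀ t, SameGap Z y t → F t < 0) := by
    intro F hF y hy h0
    rcases lt_or_gt_of_ne (h0 y (.refl hy)) with h1 | h1
    · refine .inr fun t ht => ?_
      rw [← sign_eq_neg_one_iff, ← SameGap.sign_eq hF h0 ht, sign_neg h1]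
    · refine .inl fun t ht => ?_
      rw [← sign_eq_one_iff, ← SameGap.sign_eq hF h0 ht, sign_pos h1]
  have inj : ∀ {s t}, SameGap Z s t → F s = F t → s = t := by
    intro s t hst h
    have hs : SameGap Z s s := hst.trans hst.symm
    rcases hmono s (hst.symm.right_notMem) with h1 | h1
    · exact h1.1.injOn hs hst h
    · exact h1.1.injOn hs hst h
  have step : ∀ R : Finset ℝ, (∀ ρ ∈ R, ρ ∉ Z ∧ F ρ = 0) →
      ∃ g : ℝ ≃o ℝ, (∀ z ∈ Z, g z = z) ∧ ∀ ρ ∈ R, G (g ρ) = 0 := by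
    intro R
    induction R using Finset.induction_on with
    | empty => exact fun _ => ⟨OrderIso.refl ℝ, fun _ _ => rfl, by simp⟩
    | insert ρ R hρ ih =>
      intro h
      obtain ⟨g, hgZ, hgR⟩ := ih fun ρ' h' => h ρ' (Finset.mem_insert_of_mem h')
      obtain ⟨hρZ, hρ0⟩ := h ρ (Finset.mem_insert_self _ _)
      obtain ⟨ρ', hgap, hρ'⟩ : ∃ ρ', SameGap Z ρ ρ' ∧ G ρ' = 0 := by
        by_contra! hno
        rcases const hG hρZ hno with h1 | h1
        · exact ((hpos ρ hρZ).2 h1 ρ (.refl hρZ)).ne' hρ0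
        · exact ((hneg ρ hρZ).2 h1 ρ (.refl hρZ)).ne hρ0
      have hgρ : SameGap Z ρ (g ρ) := .apply_of_fix hgZ hρZ
      obtain ⟨a, b, hab, h1, h2⟩ : ∃ a b, (∀ t ∈ Set.Ioo a b, SameGap Z ρ t) ∧
          g ρ ∈ Set.Ioo a b ∧ ρ' ∈ Set.Ioo a b := by
        have hmin : SameGap Z ρ (min (g ρ) ρ') := by
          rcases min_choice (g ρ) ρ' with h | h <;> rw [h] <;> assumption
        have hmax : SameGap Z ρ (max (g ρ) ρ') := by
          rcases max_choice (g ρ) ρ' with h | h <;> rw [h] <;> assumption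
        obtain ⟨ε, hε, h1⟩ := Metric.isOpen_iff.1 (SameGap.isOpen Z ρ) _ hmin
        obtain ⟨δ, hδ, h2⟩ := Metric.isOpen_iff.1 (SameGap.isOpen Z ρ) _ hmax
        refine ⟨min (g ρ) ρ' - ε, max (g ρ) ρ' + δ, fun t ht => ?_, ?_, ?_⟩
        · rcases lt_or_ge t (min (g ρ) ρ') with h3 | h3
          · refine h1 ?_
            rw [Metric.mem_ball, Real.dist_eq, abs_lt]
            constructor <;> linarith [ht.1]
          rcases lt_or_ge (max (g ρ) ρ') t with h4 | h4
          · refine h2 ?_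
            rw [Metric.mem_ball, Real.dist_eq, abs_lt]
            constructor <;> linarith [ht.2]
          · exact hmin.trans ((hmin.symm.trans hmax).of_between h3 h4)
        · exact ⟨by linarith [min_le_left (g ρ) ρ'], by linarith [le_max_left (g ρ) ρ']⟩
        · exact ⟨by linarith [min_le_right (g ρ) ρ'], by linarith [le_max_right (g ρ) ρ']⟩
      obtain ⟨k, hk, hk'⟩ := exists_orderIso_move h1.1 h1.2 h2.1 h2.2
      refine ⟨g.trans k, fun z hz => ?_, fun σ hσ => ?_⟩
      · rw [OrderIso.trans_apply, hgZ z hz]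
        exact hk' z fun hz' => (hab z hz').right_notMem hz
      · rw [OrderIso.trans_apply]
        rcases Finset.mem_insert.1 hσ with rfl | hσ'
        · rw [hk, hρ']
        · obtain ⟨hσZ, hσ0⟩ := h σ hσ
          rw [hk' _ fun hin => ?_, hgR σ hσ']
          have : SameGap Z ρ σ := (hab _ hin).trans (SameGap.apply_of_fix hgZ hσZ).symm
          exact hρ (inj this (hρ0.trans hσ0.symm) ▸ hσ')
  obtain ⟨g, hgZ, hgR⟩ := step (R.filter fun ρ => ρ ∉ Z ∧ F ρ = 0) fun ρ h =>
    (Finset.mem_filter.1 h).2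
  refine ⟨g, hgZ, fun y => ?_⟩
  by_cases hy : y ∈ Z
  · rw [hgZ y hy, hZ y hy]
  have hgy : SameGap Z y (g y) := .apply_of_fix hgZ hy
  by_cases hroot : ∃ ρ, SameGap Z y ρ ∧ F ρ = 0
  · obtain ⟨ρ, hyρ, hρ⟩ := hroot
    have hρ' : G (g ρ) = 0 :=
      hgR ρ (Finset.mem_filter.2 ⟨hR ρ hρ, hyρ.right_notMem, hρ⟩)
    have hgρ : SameGap Z y (g ρ) := hyρ.trans (.apply_of_fix hgZ hyρ.right_notMem)
    rcases lt_trichotomy y ρ with h | rfl | h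
    · have h' := g.strictMono h
      rcases hmono y hy with hm | hm
      · have h1 := hm.1 (SameGap.refl hy) hyρ h
        have h2 := hm.2 hgy hgρ h'
        rw [hρ] at h1; rw [hρ'] at h2
        rw [sign_neg h1, sign_neg h2]
      · have h1 := hm.1 (SameGap.refl hy) hyρ h
        have h2 := hm.2 hgy hgρ h'
        rw [hρ] at h1; rw [hρ'] at h2
        rw [sign_pos h1, sign_pos h2]
    · rw [hρ, hρ']
    · have h' := g.strictMono h
      rcases hmono y hy with hm | hm
      · have h1 := hm.1 hyρ (SameGap.refl hy) h
        have h2 := hm.2 hgρ hgy h'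
        rw [hρ] at h1; rw [hρ'] at h2
        rw [sign_pos h1, sign_pos h2]
      · have h1 := hm.1 hyρ (SameGap.refl hy) h
        have h2 := hm.2 hgρ hgy h'
        rw [hρ] at h1; rw [hρ'] at h2
        rw [sign_neg h1, sign_neg h2]
  · push Not at hroot
    rcases const hF hy hroot with h1 | h1
    · rw [sign_pos (h1 y (.refl hy)), sign_pos ((hpos y hy).1 h1 _ hgy)]
    · rw [sign_neg (h1 y (.refl hy)), sign_neg ((hneg y hy).1 h1 _ hgy)]

/-! ### Signs of a polynomial between the zeros of its derivative -/

section

variable {p : ℝ[X]} {Z : Finset ℝ} {y : ℝ}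

/-- `p` is strictly increasing on the closure of a gap of `Z` if `p'` has no zero outside `Z`
and is positive at one point of the gap. -/
lemma eval_lt_eval_of_gap (hZ : ∀ t, t ∉ Z → p.derivative.eval t ≠ 0)
    (hd : 0 < p.derivative.eval y) {a b : ℝ} (hab : a < b)
    (h : ∀ t ∈ Set.Ioo a b, SameGap Z y t) : p.eval a < p.eval b := by
  refine strictMonoOn_of_deriv_pos (convex_Icc a b) p.continuous.continuousOn (fun t ht => ?_)
    (Set.left_mem_Icc.2 hab.le) (Set.right_mem_Icc.2 hab.le) hab
  rw [interior_Icc] at ht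
  rw [Polynomial.deriv, ← sign_eq_one_iff,
    ← SameGap.sign_eq p.derivative.continuous (fun s hs => hZ s hs.right_notMem) (h t ht),
    sign_pos hd]

lemma strictMonoOn_gap (hZ : ∀ t, t ∉ Z → p.derivative.eval t ≠ 0)
    (hd : 0 < p.derivative.eval y) :
    StrictMonoOn (fun t => p.eval t) {t | SameGap Z y t} := fun _ hs _ ht hst =>
  eval_lt_eval_of_gap hZ hd hst fun _ hu =>
    hs.trans ((hs.symm.trans ht).of_between hu.1.le hu.2.le)

/-- A polynomial that increases on a gap is positive there iff the gap has a left end point, at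
which the polynomial is not negative: polynomials that are bounded on a half-line are constant. -/
lemma pos_on_gap_iff (hy : y ∉ Z) (hZ : ∀ t, t ∉ Z → p.derivative.eval t ≠ 0)
    (hd : 0 < p.derivative.eval y) :
    (∀ t, SameGap Z y t → 0 < p.eval t) ↔
      ∃ z ∈ Z, z < y ∧ (∀ w ∈ Z, w ≤ z ∨ y < w) ∧ 0 ≤ p.eval z := by
  constructor
  · intro h
    by_cases hne : (Z.filter (· < y)).Nonempty
    · obtain ⟨z, hz, hmax⟩ := (Z.filter (· < y)).exists_max_image id hne
      obtain ⟨hzZ, hzy⟩ := Finset.mem_filter.1 hz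
      have hw : ∀ w ∈ Z, w ≤ z ∨ y < w := fun w hw => by
        rcases lt_trichotomy w y with h1 | h1 | h1
        · exact .inl (hmax w (Finset.mem_filter.2 ⟨hw, h1⟩))
        · exact (hy (h1 ▸ hw)).elim
        · exact .inr h1
      refine ⟨z, hzZ, hzy, hw, ?_⟩
      have hlim : Filter.Tendsto (fun t => p.eval t) (nhdsWithin z (Set.Ioi z))
          (nhds (p.eval z)) := p.continuous.continuousAt.mono_left nhdsWithin_le_nhds
      refine ge_of_tendsto hlim ?_
      filter_upwards [Ioo_mem_nhdsGT hzy] with t ht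
      refine (h t fun w hw' => ?_).le
      rcases hw w hw' with h1 | h1
      · exact .inl ⟨h1.trans_lt hzy, h1.trans_lt ht.1⟩
      · exact .inr ⟨h1, ht.2.trans h1⟩
    · exfalso
      have hgt : ∀ w ∈ Z, y < w := fun w hw => by
        rcases lt_trichotomy w y with h1 | h1 | h1
        · exact (hne ⟨w, Finset.mem_filter.2 ⟨hw, h1⟩⟩).elim
        · exact (hy (h1 ▸ hw)).elim
        · exact h1
      have hgap : ∀ t ≤ y, SameGap Z y t := fun t ht w hw =>
        .inr ⟨hgt w hw, ht.trans_lt (hgt w hw)⟩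
      have hdeg : 0 < (p.comp (-X)).degree := by
        rw [← natDegree_pos_iff_degree_pos, natDegree_comp]
        have : p.natDegree ≠ 0 := fun h0 => by
          rw [derivative_of_natDegree_zero h0] at hd
          simp at hd
        simpa using Nat.pos_of_ne_zero this
      obtain ⟨t, h1, h2⟩ := (((p.comp (-X)).abs_tendsto_atTop hdeg).eventually_gt_atTop
        (p.eval y)).and (Filter.eventually_gt_atTop (-y)) |>.exists
      have hty : -t < y := by linarith
      rw [eval_comp, eval_neg, eval_X, abs_of_pos (h _ (hgap _ hty.le))] at h1
      exact h1.not_gt (eval_lt_eval_of_gap hZ hd hty fun s hs => hgap s hs.2.le)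
  · rintro ⟨z, hz, hzy, hw, hz0⟩ t ht
    have hzt : z < t := by
      rcases ht z hz with h1 | h1
      · exact h1.2
      · exact (h1.1.not_gt hzy).elim
    refine hz0.trans_lt (eval_lt_eval_of_gap hZ hd hzt fun s hs w hw' => ?_)
    rcases hw w hw' with h1 | h1
    · exact .inl ⟨h1.trans_lt hzy, h1.trans_lt hs.1⟩
    · refine .inr ⟨h1, ?_⟩
      rcases ht w hw' with h2 | h2
      · exact (h2.1.not_gt h1).elim
      · exact hs.2.trans h2.2

lemma neg_on_gap_iff (hy : y ∉ Z) (hZ : ∀ t, t ∉ Z → p.derivative.eval t ≠ 0)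
    (hd : 0 < p.derivative.eval y) :
    (∀ t, SameGap Z y t → p.eval t < 0) ↔
      ∃ z ∈ Z, y < z ∧ (∀ w ∈ Z, z ≤ w ∨ w < y) ∧ p.eval z ≤ 0 := by
  constructor
  · intro h
    by_cases hne : (Z.filter (y < ·)).Nonempty
    · obtain ⟨z, hz, hmin⟩ := (Z.filter (y < ·)).exists_min_image id hne
      obtain ⟨hzZ, hzy⟩ := Finset.mem_filter.1 hz
      have hw : ∀ w ∈ Z, z ≤ w ∨ w < y := fun w hw => by
        rcases lt_trichotomy w y with h1 | h1 | h1
        · exact .inr h1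
        · exact (hy (h1 ▸ hw)).elim
        · exact .inl (hmin w (Finset.mem_filter.2 ⟨hw, h1⟩))
      refine ⟨z, hzZ, hzy, hw, ?_⟩
      have hlim : Filter.Tendsto (fun t => p.eval t) (nhdsWithin z (Set.Iio z))
          (nhds (p.eval z)) := p.continuous.continuousAt.mono_left nhdsWithin_le_nhds
      refine le_of_tendsto hlim ?_
      filter_upwards [Ioo_mem_nhdsLT hzy] with t ht
      refine (h t fun w hw' => ?_).le
      rcases hw w hw' with h1 | h1
      · exact .inr ⟨hzy.trans_le h1, ht.2.trans_le h1⟩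
      · exact .inl ⟨h1, h1.trans ht.1⟩
    · exfalso
      have hlt : ∀ w ∈ Z, w < y := fun w hw => by
        rcases lt_trichotomy w y with h1 | h1 | h1
        · exact h1
        · exact (hy (h1 ▸ hw)).elim
        · exact (hne ⟨w, Finset.mem_filter.2 ⟨hw, h1⟩⟩).elim
      have hgap : ∀ t, y ≤ t → SameGap Z y t := fun t ht w hw =>
        .inl ⟨hlt w hw, (hlt w hw).trans_le ht⟩
      have hdeg : 0 < p.degree := by
        rw [← natDegree_pos_iff_degree_pos]
        refine Nat.pos_of_ne_zero fun h0 => ?_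
        rw [derivative_of_natDegree_zero h0] at hd
        simp at hd
      obtain ⟨t, h1, hty⟩ := ((p.abs_tendsto_atTop hdeg).eventually_gt_atTop
        (-p.eval y)).and (Filter.eventually_gt_atTop y) |>.exists
      rw [abs_of_neg (h _ (hgap _ hty.le))] at h1
      linarith [eval_lt_eval_of_gap hZ hd hty fun s hs => hgap s hs.1.le]
  · rintro ⟨z, hz, hzy, hw, hz0⟩ t ht
    have hzt : t < z := by
      rcases ht z hz with h1 | h1
      · exact (h1.1.not_gt hzy).elim
      · exact h1.2
    refine (eval_lt_eval_of_gap hZ hd hzt fun s hs w hw' => ?_).trans_le hz0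
    rcases hw w hw' with h1 | h1
    · exact .inr ⟨hzy.trans_le h1, hs.2.trans_le h1⟩
    · refine .inl ⟨h1, ?_⟩
      rcases ht w hw' with h2 | h2
      · exact h2.2.trans hs.1
      · exact (h2.1.not_gt h1).elim

end

/-- If an order automorphism `h` of the line respects the signs of `p'` and `q'`, and those of
`p` and `q` on a finite set `Z` that contains the zeros of `p'`, then `h` can be changed outside
`Z` so that it respects the signs of `p` and `q` everywhere. -/
lemma exists_orderIso_of_derivative {p q : ℝ[X]} (h : ℝ ≃o ℝ) {Z : Finset ℝ}
    (hZ : ∀ t, t ∉ Z → p.derivative.eval t ≠ 0)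
    (hd : ∀ y, SignType.sign (p.derivative.eval y) = SignType.sign (q.derivative.eval (h y)))
    (hpq : ∀ z ∈ Z, SignType.sign (p.eval z) = SignType.sign (q.eval (h z))) :
    ∃ k : ℝ ≃o ℝ, (∀ z ∈ Z, k z = h z) ∧
      ∀ y, SignType.sign (p.eval y) = SignType.sign (q.eval (k y)) := by
  have hp : p ≠ 0 := by
    rintro rfl
    obtain ⟨t, ht⟩ := Infinite.exists_notMem_finset Z
    exact hZ t ht (by simp)
  have hZ' : ∀ t, t ∉ Z.image h → q.derivative.eval t ≠ 0 := fun t ht => by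
    have h1 : h.symm t ∉ Z := fun h' => ht (Finset.mem_image.2 ⟨_, h', h.apply_symm_apply t⟩)
    have h2 := hd (h.symm t)
    rw [h.apply_symm_apply] at h2
    rw [← sign_ne_zero, ← h2, sign_ne_zero]
    exact hZ _ h1
  have him : ∀ {y}, y ∉ Z → h y ∉ Z.image h := fun hy hy' => by
    obtain ⟨z, hz, hzy⟩ := Finset.mem_image.1 hy'
    exact hy (h.injective hzy ▸ hz)
  -- everything follows for a gap on which `p` increases; for the other gaps `p` is negated
  have key : ∀ {p q : ℝ[X]}, (∀ t, t ∉ Z → p.derivative.eval t ≠ 0) →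
      (∀ t, t ∉ Z.image h → q.derivative.eval t ≠ 0) →
      (∀ z ∈ Z, SignType.sign (p.eval z) = SignType.sign (q.eval (h z))) →
      ∀ {y}, y ∉ Z → 0 < p.derivative.eval y → 0 < q.derivative.eval (h y) →
      (StrictMonoOn (fun t => p.eval t) {t | SameGap Z y t} ∧
        StrictMonoOn (fun t => q.eval (h t)) {t | SameGap Z y t}) ∧
      ((∀ t, SameGap Z y t → 0 < p.eval t) ↔ ∀ t, SameGap Z y t → 0 < q.eval (h t)) ∧
      ((∀ t, SameGap Z y t → p.eval t < 0) ↔ ∀ t, SameGap Z y t → q.eval (h t) < 0) := by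
    intro p q hp hq hpq y hy hpy hqy
    have tr : ∀ P : ℝ → Prop, (∀ t, SameGap (Z.image h) (h y) t → P t) ↔
        ∀ t, SameGap Z y t → P (h t) := fun P =>
      ⟨fun H t ht => H _ (ht.map h), fun H t ht => by
        have := H (h.symm t) (.of_map h (by rwa [h.apply_symm_apply]))
        rwa [h.apply_symm_apply] at this⟩
    refine ⟨⟨strictMonoOn_gap hp hpy, fun s hs t ht hst =>
      strictMonoOn_gap hq hqy (hs.map h) (ht.map h) (h.strictMono hst)⟩, ?_, ?_⟩
    · rw [← tr fun t => 0 < q.eval t, pos_on_gap_iff hy hp hpy, pos_on_gap_iff (him hy) hq hqy,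
        Finset.exists_mem_image]
      refine exists_congr fun z => and_congr_right fun hz => ?_
      rw [Finset.forall_mem_image, ← not_lt, ← sign_eq_neg_one_iff, hpq z hz,
        sign_eq_neg_one_iff, not_lt]
      simp
    · rw [← tr fun t => q.eval t < 0, neg_on_gap_iff hy hp hpy, neg_on_gap_iff (him hy) hq hqy,
        Finset.exists_mem_image]
      refine exists_congr fun z => and_congr_right fun hz => ?_
      rw [Finset.forall_mem_image, ← not_lt, ← sign_eq_one_iff, hpq z hz,
        sign_eq_one_iff, not_lt]
      simp
  have hpos : ∀ y, 0 < p.derivative.eval y → 0 < q.derivative.eval (h y) := fun y hy => by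
    rwa [← sign_eq_one_iff, ← hd, sign_eq_one_iff]
  have hneg : ∀ y, p.derivative.eval y < 0 → q.derivative.eval (h y) < 0 := fun y hy => by
    rwa [← sign_eq_neg_one_iff, ← hd, sign_eq_neg_one_iff]
  have key_neg : ∀ {y}, y ∉ Z → p.derivative.eval y < 0 → _ := fun {y} hy hpy =>
    key (p := -p) (q := -q) (by simpa using hZ) (by simpa using hZ')
      (by simpa [Left.sign_neg] using hpq) hy (by simpa using hpy) (by simpa using hneg y hpy)
  suffices H : ∃ g : ℝ ≃o ℝ, (∀ z ∈ Z, g z = z) ∧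
      ∀ y, SignType.sign (p.eval y) = SignType.sign (q.eval (h (g y))) by
    obtain ⟨g, hg, hg'⟩ := H
    exact ⟨g.trans h, fun z hz => by simp [hg z hz], hg'⟩
  refine exists_orderIso_sign_eq (F := fun t => p.eval t)
    (G := fun t => q.eval (h t)) (Z := Z) (R := p.roots.toFinset) p.continuous
    (q.continuous.comp h.continuous) (fun y hy => by simpa [hp] using hy) hpq
    (fun y hy => ?_) (fun y hy => ?_) (fun y hy => ?_)
  · rcases lt_or_gt_of_ne (hZ y hy) with hpy | hpy
    · obtain ⟨⟨h1, h2⟩, -⟩ := key_neg hy hpy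
      refine .inr ⟨fun s hs t ht hst => ?_, fun s hs t ht hst => ?_⟩
      · simpa using h1 hs ht hst
      · simpa using h2 hs ht hst
    · exact .inl (key hZ hZ' hpq hy hpy (hpos y hpy)).1
  · rcases lt_or_gt_of_ne (hZ y hy) with hpy | hpy
    · simpa using (key_neg hy hpy).2.2
    · exact (key hZ hZ' hpq hy hpy (hpos y hpy)).2.1
  · rcases lt_or_gt_of_ne (hZ y hy) with hpy | hpy
    · simpa using (key_neg hy hpy).2.1
    · exact (key hZ hZ' hpq hy hpy (hpos y hpy)).2.2

/-! ### Elimination of one real quantifier -/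

/-- Pseudo-division. The power of the leading coefficient is even, so that it does not change
signs. -/
lemma exists_pseudoRemainder {R : Type*} [CommRing R] (p q : R[X]) (hq : 0 < q.natDegree) :
    ∃ r : R[X], r.natDegree < q.natDegree ∧
      ∃ (k : ℕ) (s : R[X]), C (q.leadingCoeff ^ (2 * k)) * p = q * s + r := by
  have key : ∀ n, ∀ p : R[X], p.natDegree ≤ n → ∃ r : R[X], r.natDegree < q.natDegree ∧
      ∃ (k : ℕ) (s : R[X]), C (q.leadingCoeff ^ k) * p = q * s + r := by
    intro n
    induction n with
    | zero => exact fun p hp => ⟨p, by omega, 0, 0, by simp⟩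
    | succ n ih =>
      intro p hp
      by_cases h : p.natDegree < q.natDegree
      · exact ⟨p, h, 0, 0, by simp⟩
      have hle : (C q.leadingCoeff * p - q * (C p.leadingCoeff *
          X ^ (p.natDegree - q.natDegree))).natDegree ≤ n := by
        have h1 : (C q.leadingCoeff * p - q * (C p.leadingCoeff *
            X ^ (p.natDegree - q.natDegree))).natDegree ≤ p.natDegree := by
          refine (natDegree_sub_le _ _).trans (max_le (natDegree_C_mul_le _ _) ?_)
          refine natDegree_mul_le.trans ?_
          have := natDegree_C_mul_X_pow_le p.leadingCoeff (p.natDegree - q.natDegree)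
          omega
        have h2 := natDegree_le_pred h1 (by
          rw [coeff_sub, coeff_C_mul, ← mul_assoc, mul_comm q, mul_assoc, coeff_C_mul,
            coeff_mul_X_pow', if_pos (Nat.sub_le _ _), Nat.sub_sub_self (not_lt.1 h)]
          simp [mul_comm])
        omega
      obtain ⟨r, hr, k, s, hs⟩ := ih _ hle
      refine ⟨r, hr, k + 1, s + C (q.leadingCoeff ^ k) * (C p.leadingCoeff *
        X ^ (p.natDegree - q.natDegree)), ?_⟩
      rw [mul_sub, sub_eq_iff_eq_add] at hs
      rw [pow_succ, C_mul, mul_assoc, hs]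
      ring
  obtain ⟨r, hr, k, s, hs⟩ := key _ p le_rfl
  refine ⟨C (q.leadingCoeff ^ k) * r, (natDegree_C_mul_le _ _).trans_lt hr, k,
    C (q.leadingCoeff ^ k) * s, ?_⟩
  rw [two_mul, pow_add, C_mul, mul_assoc, hs]
  ring

/-- The real polynomial obtained by evaluating the coefficients of `q` at `A`. -/
def evalCoeffs (A : Fin m → ℝ) (q : (MvPolynomial (Fin m) ℚ)[X]) : ℝ[X] :=
  q.map (MvPolynomial.aeval A : MvPolynomial (Fin m) ℚ →ₐ[ℚ] ℝ).toRingHom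

/-- The polynomials of `T` have the same signs at `A` and `B`. -/
def SameSigns (T : Finset (MvPolynomial (Fin m) ℚ)) (A B : Fin m → ℝ) : Prop :=
  ∀ c ∈ T, SignType.sign (MvPolynomial.aeval A c) = SignType.sign (MvPolynomial.aeval B c)

/-- The polynomials of `L`, specialized to `A` and to `B`, have the same sign diagram: an order
automorphism of the line transforms the signs of the ones into those of the others. -/
def SameDiagram (L : Multiset (MvPolynomial (Fin m) ℚ)[X]) (A B : Fin m → ℝ) : Prop :=
  ∃ h : ℝ ≃o ℝ, ∀ q ∈ L, ∀ y, SignType.sign ((evalCoeffs A q).eval y) =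
    SignType.sign ((evalCoeffs B q).eval (h y))

lemma evalCoeffs_eraseLead {A : Fin m → ℝ} {q : (MvPolynomial (Fin m) ℚ)[X]}
    (h : MvPolynomial.aeval A q.leadingCoeff = 0) :
    evalCoeffs A q.eraseLead = evalCoeffs A q := by
  have h1 := congrArg (evalCoeffs A) (eraseLead_add_C_mul_X_pow q)
  have h2 : (MvPolynomial.aeval A : MvPolynomial (Fin m) ℚ →ₐ[ℚ] ℝ).toRingHom
      q.leadingCoeff = 0 := h
  rw [evalCoeffs, Polynomial.map_add, Polynomial.map_mul, map_C, h2, C_0, zero_mul, add_zero] at h1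
  exact h1

lemma evalCoeffs_of_natDegree_eq_zero {A : Fin m → ℝ} {q : (MvPolynomial (Fin m) ℚ)[X]}
    (h : q.natDegree = 0) : evalCoeffs A q = C (MvPolynomial.aeval A q.leadingCoeff) := by
  rw [leadingCoeff, h]
  conv_lhs => rw [eq_C_of_natDegree_eq_zero h]
  simp [evalCoeffs]

lemma evalCoeffs_ne_zero {A : Fin m → ℝ} {q : (MvPolynomial (Fin m) ℚ)[X]}
    (h : MvPolynomial.aeval A q.leadingCoeff ≠ 0) : evalCoeffs A q ≠ 0 := fun h0 => by
  refine h ?_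
  have := congrArg (fun r => r.coeff q.natDegree) h0
  simpa [evalCoeffs] using this

lemma evalCoeffs_derivative (A : Fin m → ℝ) (q : (MvPolynomial (Fin m) ℚ)[X]) :
    evalCoeffs A (derivative q) = derivative (evalCoeffs A q) :=
  (derivative_map _ _).symm

lemma leadingCoeff_derivative_eq {R : Type*} [CommRing R] [IsDomain R] [CharZero R] {q : R[X]}
    (h : 0 < q.natDegree) : (derivative q).leadingCoeff = q.leadingCoeff * q.natDegree := by
  rw [leadingCoeff, natDegree_derivative, coeff_derivative, Nat.sub_add_cancel h]
  have : ((q.natDegree - 1 : ℕ) : R) + 1 = q.natDegree := by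
    exact_mod_cast congrArg (Nat.cast (R := R)) (Nat.sub_add_cancel h)
  rw [this, leadingCoeff]

/-- At a root of `q`, a polynomial has the sign of its pseudo-remainder modulo `q`. -/
lemma sign_eq_of_pseudoRemainder {A : Fin m → ℝ} {p q r s : (MvPolynomial (Fin m) ℚ)[X]} {k : ℕ}
    (h : C (q.leadingCoeff ^ (2 * k)) * p = q * s + r)
    (hA : MvPolynomial.aeval A q.leadingCoeff ≠ 0) {z : ℝ} (hz : (evalCoeffs A q).eval z = 0) :
    SignType.sign ((evalCoeffs A p).eval z) = SignType.sign ((evalCoeffs A r).eval z) := by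
  have h1 := congrArg (fun f => (evalCoeffs A f).eval z) h
  have h2 : (MvPolynomial.aeval A q.leadingCoeff) ^ (2 * k) * (evalCoeffs A p).eval z =
      (evalCoeffs A r).eval z := by
    simp only [evalCoeffs, Polynomial.map_mul, Polynomial.map_add, eval_mul, eval_add] at h1 hz ⊢
    rw [hz, zero_mul, zero_add, map_C, eval_C, map_pow] at h1
    exact h1
  have h3 : 0 < (MvPolynomial.aeval A q.leadingCoeff) ^ (2 * k) := by
    rw [pow_mul]
    positivity
  rw [← h2, sign_mul, sign_pos h3, one_mul]

/-- The sign diagram of finitely many polynomials is determined by the signs of finitely many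
polynomials in the parameters. A polynomial whose leading coefficient vanishes is truncated;
otherwise a polynomial of highest degree is traded for its derivative and for its
pseudo-remainders modulo the others, which determine its signs at their roots. -/
theorem exists_sameSigns_imp_sameDiagram (L : Multiset (MvPolynomial (Fin m) ℚ)[X]) :
    ∃ T : Finset (MvPolynomial (Fin m) ℚ), ∀ A B : Fin m → ℝ,
      SameSigns T A B → SameDiagram L A B := by
  induction L using (InvImage.wf (fun L : Multiset (MvPolynomial (Fin m) ℚ)[X] =>
    L.map natDegree) Multiset.wellFounded_isDershowitzMannaLT).induction with
  | h L ih =>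
  by_cases hconst : ∀ q ∈ L, q.natDegree = 0
  · refine ⟨L.toFinset.image leadingCoeff, fun A B h => ⟨OrderIso.refl ℝ, fun q hq y => ?_⟩⟩
    rw [evalCoeffs_of_natDegree_eq_zero (hconst q hq),
      evalCoeffs_of_natDegree_eq_zero (hconst q hq), eval_C, eval_C]
    exact h _ (Finset.mem_image_of_mem _ (Multiset.mem_toFinset.2 hq))
  push Not at hconst
  obtain ⟨p, hpL, hpmax⟩ : ∃ p ∈ L, ∀ q ∈ L, q.natDegree ≤ p.natDegree := by
    obtain ⟨q, hq, -⟩ := hconst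
    obtain ⟨p, hp, hmax⟩ := L.toFinset.exists_max_image natDegree
      ⟨q, Multiset.mem_toFinset.2 hq⟩
    exact ⟨p, Multiset.mem_toFinset.1 hp, fun q hq => hmax q (Multiset.mem_toFinset.2 hq)⟩
  have hppos : 0 < p.natDegree := by
    obtain ⟨q, hq, hq0⟩ := hconst
    exact (Nat.pos_of_ne_zero hq0).trans_le (hpmax q hq)
  obtain ⟨L₀, rfl⟩ := Multiset.exists_cons_of_mem hpL
  -- truncation
  have hT₁ : ∀ q ∈ p ::ₘ L₀, 0 < q.natDegree → ∃ T : Finset (MvPolynomial (Fin m) ℚ),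
      ∀ A B, SameSigns T A B → MvPolynomial.aeval A q.leadingCoeff = 0 →
        MvPolynomial.aeval B q.leadingCoeff = 0 → SameDiagram (p ::ₘ L₀) A B := by
    intro q hq hqpos
    obtain ⟨M, hM⟩ := Multiset.exists_cons_of_mem hq
    rw [hM]
    obtain ⟨T, hT⟩ := ih (q.eraseLead ::ₘ M) (by
      rw [hM]
      refine ⟨M.map natDegree, {q.eraseLead.natDegree}, {q.natDegree}, by simp, ?_, ?_, ?_⟩
      · exact (Multiset.map_cons _ _ _).trans (by rw [add_comm, Multiset.singleton_add])
      · exact (Multiset.map_cons _ _ _).trans (by rw [add_comm, Multiset.singleton_add])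
      · simpa using (eraseLead_natDegree_le q).trans_lt (by omega))
    refine ⟨T, fun A B hAB hA hB => ?_⟩
    obtain ⟨h, hh⟩ := hT A B hAB
    refine ⟨h, fun r hr y => ?_⟩
    rcases Multiset.mem_cons.1 hr with rfl | hr
    · rw [← evalCoeffs_eraseLead hA, ← evalCoeffs_eraseLead hB]
      exact hh _ (Multiset.mem_cons_self _ _) y
    · exact hh _ (Multiset.mem_cons_of_mem hr) y
  choose! T₁ hT₁ using hT₁
  choose! rem hrem hrem' using fun (q : (MvPolynomial (Fin m) ℚ)[X]) (hq : 0 < q.natDegree) =>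
    exists_pseudoRemainder p q hq
  -- trading `p` for its derivative and its pseudo-remainders
  let D : Multiset (MvPolynomial (Fin m) ℚ)[X] := derivative p ::ₘ L₀
  have hDle : ∀ q ∈ D, q.natDegree ≤ p.natDegree := by
    intro q hq
    rcases Multiset.mem_cons.1 hq with rfl | hq
    · exact (natDegree_derivative_lt hppos.ne').le
    · exact hpmax q (Multiset.mem_cons_of_mem hq)
  let N : Multiset (MvPolynomial (Fin m) ℚ)[X] := (D.filter fun q => 0 < q.natDegree).map rem
  obtain ⟨T₂, hT₂⟩ := ih (D + N) (by
    refine ⟨L₀.map natDegree, (derivative p ::ₘ N).map natDegree, {p.natDegree}, by simp,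
      ?_, ?_, ?_⟩
    · simp only [D, ← Multiset.map_add]
      congr 1
      rw [Multiset.cons_add, Multiset.add_cons]
    · exact (Multiset.map_cons _ _ _).trans (by rw [add_comm, Multiset.singleton_add])
    · intro d hd
      obtain ⟨q, hq, rfl⟩ := Multiset.mem_map.1 hd
      refine ⟨p.natDegree, by simp, ?_⟩
      rcases Multiset.mem_cons.1 hq with rfl | hq
      · exact natDegree_derivative_lt hppos.ne'
      · obtain ⟨q, hq', rfl⟩ := Multiset.mem_map.1 hq
        obtain ⟨hqD, hqpos⟩ := Multiset.mem_filter.1 hq'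
        exact (hrem q hqpos).trans_le (hDle q hqD))
  refine ⟨(p ::ₘ L₀).toFinset.image leadingCoeff ∪ (p ::ₘ L₀).toFinset.biUnion T₁ ∪ T₂,
    fun A B hAB => ?_⟩
  have hlc : ∀ q ∈ p ::ₘ L₀, SignType.sign (MvPolynomial.aeval A q.leadingCoeff) =
      SignType.sign (MvPolynomial.aeval B q.leadingCoeff) := fun q hq =>
    hAB _ (Finset.mem_union_left _ (Finset.mem_union_left _
      (Finset.mem_image_of_mem _ (Multiset.mem_toFinset.2 hq))))
  by_cases hzero : ∃ q ∈ p ::ₘ L₀, 0 < q.natDegree ∧ MvPolynomial.aeval A q.leadingCoeff = 0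
  · obtain ⟨q, hq, hqpos, hqA⟩ := hzero
    refine hT₁ q hq hqpos A B (fun c hc => hAB c ?_) hqA ?_
    · exact Finset.mem_union_left _ (Finset.mem_union_right _
        (Finset.mem_biUnion.2 ⟨q, Multiset.mem_toFinset.2 hq, hc⟩))
    · rw [← sign_eq_zero_iff, ← hlc q hq, hqA, sign_zero]
  push Not at hzero
  obtain ⟨h, hh⟩ := hT₂ A B fun c hc => hAB c (Finset.mem_union_right _ hc)
  have hlcA : ∀ q ∈ D, 0 < q.natDegree → MvPolynomial.aeval A q.leadingCoeff ≠ 0 ∧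
      MvPolynomial.aeval B q.leadingCoeff ≠ 0 := by
    have hL : ∀ q ∈ p ::ₘ L₀, 0 < q.natDegree → MvPolynomial.aeval A q.leadingCoeff ≠ 0 ∧
        MvPolynomial.aeval B q.leadingCoeff ≠ 0 := fun q hq hqpos => by
      refine ⟨hzero q hq hqpos, ?_⟩
      rw [← sign_ne_zero, ← hlc q hq, sign_ne_zero]
      exact hzero q hq hqpos
    intro q hq hqpos
    rcases Multiset.mem_cons.1 hq with rfl | hq
    · have := hL p (Multiset.mem_cons_self _ _) hppos
      rw [leadingCoeff_derivative_eq hppos]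
      simpa [hppos.ne'] using this
    · exact hL q (Multiset.mem_cons_of_mem hq) hqpos
  let Z : Finset ℝ := D.toFinset.biUnion fun q => (evalCoeffs A q).roots.toFinset
  have hZ : ∀ q ∈ D, evalCoeffs A q ≠ 0 → ∀ t, t ∉ Z → (evalCoeffs A q).eval t ≠ 0 := by
    intro q hq hq0 t ht h0
    exact ht (Finset.mem_biUnion.2 ⟨q, Multiset.mem_toFinset.2 hq, by simpa [hq0] using h0⟩)
  have hsame : ∀ q ∈ D, ∀ y, SignType.sign ((evalCoeffs A q).eval y) =
      SignType.sign ((evalCoeffs B q).eval (h y)) := fun q hq =>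
    hh q (Multiset.mem_add.2 (.inl hq))
  have hpZ : ∀ z ∈ Z, SignType.sign ((evalCoeffs A p).eval z) =
      SignType.sign ((evalCoeffs B p).eval (h z)) := by
    intro z hz
    obtain ⟨q, hq, hqz⟩ := Finset.mem_biUnion.1 hz
    rw [Multiset.mem_toFinset] at hq
    rw [Multiset.mem_toFinset, mem_roots'] at hqz
    have hqpos : 0 < q.natDegree := by
      refine Nat.pos_of_ne_zero fun h0 => hqz.1 ?_
      have := hqz.2
      rw [evalCoeffs_of_natDegree_eq_zero h0, IsRoot.def, eval_C] at this
      rw [evalCoeffs_of_natDegree_eq_zero h0, this, C_0]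
    obtain ⟨k, s, hs⟩ := hrem' q hqpos
    have hzB : (evalCoeffs B q).eval (h z) = 0 := by
      rw [← sign_eq_zero_iff, ← hsame q hq, hqz.2, sign_zero]
    rw [sign_eq_of_pseudoRemainder hs (hlcA q hq hqpos).1 hqz.2,
      sign_eq_of_pseudoRemainder hs (hlcA q hq hqpos).2 hzB]
    exact hh _ (Multiset.mem_add.2 (.inr (Multiset.mem_map_of_mem _
      (Multiset.mem_filter.2 ⟨hq, hqpos⟩)))) z
  have hpD : derivative p ∈ D := Multiset.mem_cons_self _ _
  have hpA : evalCoeffs A (derivative p) ≠ 0 := by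
    refine evalCoeffs_ne_zero ?_
    rw [leadingCoeff_derivative_eq hppos]
    simpa [hppos.ne'] using hzero p (Multiset.mem_cons_self _ _) hppos
  obtain ⟨k, hk, hk'⟩ := exists_orderIso_of_derivative (p := evalCoeffs A p)
    (q := evalCoeffs B p) h (Z := Z)
    (by rw [← evalCoeffs_derivative]; exact hZ _ hpD hpA)
    (by rw [← evalCoeffs_derivative, ← evalCoeffs_derivative]; exact hsame _ hpD) hpZ
  refine ⟨k, fun q hq y => ?_⟩
  rcases Multiset.mem_cons.1 hq with rfl | hq
  · exact hk' y
  have hqD : q ∈ D := Multiset.mem_cons_of_mem hq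
  by_cases hy : y ∈ Z
  · rw [hk y hy]
    exact hsame q hqD y
  -- `h⁻¹ ∘ k` fixes `Z`, so it moves `y` only inside its gap, where `q` has constant sign
  have hgap : SameGap Z y (h.symm (k y)) :=
    SameGap.apply_of_fix (g := k.trans h.symm) (fun z hz => by simp [hk z hz]) hy
  have hgap' : SignType.sign ((evalCoeffs A q).eval y) =
      SignType.sign ((evalCoeffs A q).eval (h.symm (k y))) := by
    by_cases h0 : evalCoeffs A q = 0
    · simp [h0]
    · exact SameGap.sign_eq (evalCoeffs A q).continuous
        (fun t ht => hZ q hqD h0 t ht.right_notMem) hgap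
  rw [hgap', hsame q hqD, h.apply_symm_apply]

/-- A set of parameters is described by a formula if membership is determined by the signs of
finitely many polynomials. -/
lemma exists_formula_of_sameSigns (T : Finset (MvPolynomial (Fin m) ℚ)) :
    ∀ S : Set (Fin m → ℝ), (∀ A B, SameSigns T A B → A ∈ S → B ∈ S) →
      ∃ ψ : Formula (Fin m), ∀ A, ψ.Holds A ↔ A ∈ S := by
  induction T using Finset.induction_on with
  | empty =>
    intro S hS
    by_cases h : S.Nonempty
    · obtain ⟨A, hA⟩ := h
      exact ⟨.tru, fun B => iff_of_true (Formula.holds_tru B) (hS A B (by simp [SameSigns]) hA)⟩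
    · exact ⟨.not .tru, fun B => iff_of_false (fun hB => hB (Formula.holds_tru B))
        fun hB => h ⟨B, hB⟩⟩
  | insert c T _ ih =>
    intro S hS
    -- `S` is split according to the sign of `c`
    have hσ : ∀ σ : SignType, ∃ ψ : Formula (Fin m), ∀ A, ψ.Holds A ↔
        ∃ B ∈ S, SignType.sign (MvPolynomial.aeval B c) = σ ∧ SameSigns T B A := fun σ =>
      ih {A | ∃ B ∈ S, SignType.sign (MvPolynomial.aeval B c) = σ ∧ SameSigns T B A}
        fun A A' hA => fun ⟨B, hB, hBσ, hBA⟩ =>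
          ⟨B, hB, hBσ, fun t ht => (hBA t ht).trans (hA t ht)⟩
    choose ψ hψ using hσ
    refine ⟨.or (.and (.atom c .lt) (ψ (-1))) (.or (.and (.atom c .gt) (ψ 1))
      (.and (.eqZero c) (ψ 0))), fun A => ?_⟩
    have hA : (Formula.or (.and (.atom c .lt) (ψ (-1))) (.or (.and (.atom c .gt) (ψ 1))
        (.and (.eqZero c) (ψ 0)))).Holds A ↔
        (ψ (SignType.sign (MvPolynomial.aeval A c))).Holds A := by
      change (MvPolynomial.aeval A c < 0 ∧ _) ∨ (MvPolynomial.aeval A c > 0 ∧ _) ∨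
        ((Formula.eqZero c).Holds A ∧ _) ↔ _
      rw [Formula.holds_eqZero]
      rcases lt_trichotomy (MvPolynomial.aeval A c) 0 with h | h | h
      · simp [h, h.ne, h.not_gt]
      · simp [h]
      · simp [h, h.ne', h.not_gt]
    rw [hA, hψ]
    constructor
    · rintro ⟨B, hB, hBσ, hBA⟩
      exact hS B A (Finset.forall_mem_insert _ _ _ |>.2 ⟨hBσ, hBA⟩) hB
    · exact fun h => ⟨A, h, rfl, fun _ _ => rfl⟩

/-- Elimination of one existential quantifier over the reals. -/
theorem exists_isElim (χ : Spec m 1) : ∃ ψ : Formula (Fin m), IsElim ψ χ := by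
  obtain ⟨T, hT⟩ := exists_sameSigns_imp_sameDiagram
    (Multiset.ofList (χ.atoms.map fun a => asPolyInOutput a.1))
  refine exists_formula_of_sameSigns T {A | ∃ y : ℝ, χ.Holds (Sum.elim A fun _ => y)} ?_
  rintro A B hAB ⟨y, hy⟩
  obtain ⟨h, hh⟩ := hT A B hAB
  refine ⟨h y, (χ.holds_congr_sign _ _ fun a ha => ?_).1 hy⟩
  rw [← eval_map_asPolyInOutput, ← eval_map_asPolyInOutput]
  exact hh _ (by simpa using ⟨a.1, ⟨a.2, ha⟩, rfl⟩) y

/-! ### Candidates for rational roots -/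

lemma mem_factors {k d : ℕ} (hk : 0 < k) (hd : d ∣ k) : d ∈ factors k := by
  simp only [factors, List.mem_filter, List.mem_range, decide_eq_true_eq]
  exact ⟨Nat.lt_succ_of_le (Nat.le_of_dvd hk hd), hk, hd⟩

/-- The polynomial with integer coefficients that is obtained by clearing denominators. -/
lemma exists_map_eq_denomLcm_mul (q : ℚ[X]) :
    ∃ P : ℤ[X], P.map (Int.castRingHom ℚ) = C (denomLcm q : ℚ) * q := by
  have h : C (denomLcm q : ℚ) * q ∈ lifts (Int.castRingHom ℚ) := by
    rw [lifts_iff_coeff_lifts]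
    intro i
    rw [coeff_C_mul]
    by_cases hi : i ∈ q.support
    · obtain ⟨c, hc⟩ : (q.coeff i).den ∣ denomLcm q := Finset.dvd_lcm hi
      refine ⟨c * (q.coeff i).num, ?_⟩
      rw [hc]
      conv_rhs => rw [← Rat.num_div_den (q.coeff i)]
      have : ((q.coeff i).den : ℚ) ≠ 0 := by exact_mod_cast (q.coeff i).den_ne_zero
      simp only [Nat.cast_mul, map_mul, eq_intCast, Int.cast_natCast, Rat.num_div_den]
      conv_lhs => rw [← Rat.mul_den_eq_num]
      ring
    · exact ⟨0, by simp [notMem_support_iff.1 hi]⟩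
  exact (mem_lifts _).1 h

lemma denomLcm_ne_zero (q : ℚ[X]) : denomLcm q ≠ 0 := by
  intro h
  obtain ⟨i, -, hi⟩ := Finset.lcm_eq_zero_iff.1 h
  exact (q.coeff i).den_ne_zero hi

/-- Every rational root of a non-zero polynomial is a candidate: this is the rational root theorem
for the integral polynomial that is obtained by clearing denominators and splitting off a power of
the variable. -/
lemma mem_candRatRoot {q : ℚ[X]} (hq : q ≠ 0) {b : ℚ} (hb : q.eval b = 0) :
    b ∈ candRatRoot q := by
  unfold candRatRoot
  simp only [List.mem_append]
  rcases eq_or_ne b 0 with rfl | hb0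
  · left
    rw [if_neg]
    · simp
    rw [natTrailingDegree_eq_zero]
    simpa [hq, coeff_zero_eq_eval_zero] using hb
  right
  obtain ⟨P, hP⟩ := exists_map_eq_denomLcm_mul q
  have hD : (denomLcm q : ℚ) ≠ 0 := by exact_mod_cast denomLcm_ne_zero q
  have hcoeff : ∀ i, ((P.coeff i : ℤ) : ℚ) = denomLcm q * q.coeff i := fun i => by
    have := congrArg (fun r => r.coeff i) hP
    simpa using this
  have hnum : ∀ i, ((denomLcm q : ℚ) * q.coeff i).num = P.coeff i := fun i => by
    rw [← hcoeff, Rat.num_intCast]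
  obtain ⟨P₁, hP₁⟩ : X ^ q.natTrailingDegree ∣ P := by
    rw [X_pow_dvd_iff]
    intro i hi
    have := hcoeff i
    rw [coeff_eq_zero_of_lt_natTrailingDegree hi, mul_zero] at this
    exact_mod_cast this
  have hroot : aeval b P₁ = 0 := by
    have h1 : aeval b P = 0 := by
      rw [aeval_def, eval₂_eq_eval_map]
      change eval b (P.map (Int.castRingHom ℚ)) = 0
      rw [hP, eval_mul, hb, mul_zero]
    rw [hP₁, map_mul, map_pow, aeval_X] at h1
    exact (mul_eq_zero.1 h1).resolve_left (pow_ne_zero _ hb0)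
  have hlow : P₁.coeff 0 = P.coeff q.natTrailingDegree := by
    rw [hP₁, coeff_X_pow_mul']
    simp
  have hhigh : P₁.leadingCoeff = P.coeff q.natDegree := by
    have h1 : P.natDegree = q.natDegree := by
      rw [← natDegree_map_eq_of_injective (RingHom.injective_int (Int.castRingHom ℚ)) P, hP,
        natDegree_C_mul hD]
    rw [← h1]
    change _ = P.leadingCoeff
    rw [hP₁, leadingCoeff_mul, leadingCoeff_X_pow, one_mul]
  have hu : b.num.natAbs ∣ ((denomLcm q : ℚ) * q.trailingCoeff).num.natAbs := by
    rw [trailingCoeff, hnum, Int.natAbs_dvd_natAbs, ← hlow]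
    exact (Rat.isFractionRingNum b).symm.dvd.trans (num_dvd_of_is_root hroot)
  have hv : b.den ∣ ((denomLcm q : ℚ) * q.leadingCoeff).num.natAbs := by
    rw [leadingCoeff, hnum, ← hhigh, ← Rat.isFractionRingDen b, Int.natAbs_dvd_natAbs]
    exact den_dvd_of_is_root hroot
  have hpos : ∀ c : ℚ, c ≠ 0 → 0 < ((denomLcm q : ℚ) * c).num.natAbs := fun c hc =>
    Int.natAbs_pos.2 (Rat.num_ne_zero.2 (mul_ne_zero hD hc))
  -- the factors are coerced to rationals as lists, by a monadic bind
  simp only [List.mem_flatMap, List.bind_eq_flatMap, List.pure_def]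
  refine ⟨(b.num.natAbs : ℚ), ⟨_, mem_factors (hpos _ (trailingCoeff_nonzero_iff_nonzero.2 hq)) hu,
    List.mem_singleton_self _⟩, (b.den : ℚ),
    ⟨_, mem_factors (hpos _ (leadingCoeff_ne_zero.2 hq)) hv, List.mem_singleton_self _⟩, ?_⟩
  have habs : ((b.num.natAbs : ℕ) : ℚ) / b.den = |b| := by
    conv_rhs => rw [← Rat.num_div_den b]
    rw [abs_div, Nat.abs_cast, Nat.cast_natAbs, Int.cast_abs]
  rw [habs]
  rcases abs_choice b with h | h <;> simp [h]

/-! ### Sample points between isolating intervals -/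

/-- The part of `exists_mem_samplePoints` for a point `x` to the right of all points of `Z` below
the right end of the first interval `I`. The inductive step replaces `I` by the next interval,
unless a point of `Z` in the latter lies to the right of `x`. -/
lemma exists_mem_gapPoints {Z : Set ℝ} : ∀ (L : List (ℚ × ℚ)) (I : ℚ × ℚ),
    (I :: L).Pairwise (fun I J => I.2 ≤ J.1) →
    (∀ J ∈ I :: L, J.1 < J.2) →
    (∀ J ∈ I :: L, ∀ z ∈ Z, ∀ w ∈ Z, z ∈ Set.Ioo (J.1 : ℝ) J.2 → w ∈ Set.Ioo (J.1 : ℝ) J.2 →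
      z = w) →
    (∀ z ∈ Z, (I.2 : ℝ) ≤ z → ∃ J ∈ L, z ∈ Set.Ioo (J.1 : ℝ) J.2) →
    ∀ x, x ∉ Z → (∀ z ∈ Z, z < (I.2 : ℝ) → z < x) →
    ∃ a ∈ gapPoints (I :: L), ∀ z ∈ Z, z ∉ Set.uIcc x (a : ℝ) := by
  have out : ∀ {x a z : ℝ}, (z < x ∧ z < a) ∨ (x < z ∧ a < z) → z ∉ Set.uIcc x a := by
    intro x a z h hz
    rw [Set.mem_uIcc] at hz
    rcases h with h | h <;> rcases hz with hz | hz <;> linarith [h.1, h.2, hz.1, hz.2]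
  intro L
  induction L with
  | nil =>
    intro I _ _ _ hcov x hx hlt
    refine ⟨I.2 + 1, by simp [gapPoints], fun z hz => out (.inl ?_)⟩
    have hzI : z < (I.2 : ℝ) := by
      by_contra h
      obtain ⟨J, hJ, -⟩ := hcov z hz (not_lt.1 h)
      simp at hJ
    refine ⟨hlt z hz hzI, ?_⟩
    push_cast
    linarith
  | cons J L ih =>
    intro I hpw hlt huniq hcov x hx hIx
    have hIJ : (I.2 : ℝ) ≤ J.1 := by
      exact_mod_cast (List.pairwise_cons.1 hpw).1 J (by simp)
    have hJ12 : (J.1 : ℝ) < J.2 := by exact_mod_cast hlt J (by simp)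
    have hpw' := (List.pairwise_cons.1 hpw).2
    have hlater : ∀ K ∈ L, (J.2 : ℝ) ≤ K.1 := fun K hK => by
      exact_mod_cast (List.pairwise_cons.1 hpw').1 K hK
    by_cases hJx : ∀ z ∈ Z, z < (J.2 : ℝ) → z < x
    · obtain ⟨a, ha, ha'⟩ := ih J hpw' (fun K hK => hlt K (List.mem_cons_of_mem _ hK))
        (fun K hK => huniq K (List.mem_cons_of_mem _ hK)) (fun z hz hJz => by
          obtain ⟨K, hK, hzK⟩ := hcov z hz (by linarith)
          rcases List.mem_cons.1 hK with rfl | hK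
          · exact (hzK.2.not_ge hJz).elim
          · exact ⟨K, hK, hzK⟩) x hx hJx
      exact ⟨a, by rw [gapPoints]; exact List.mem_cons_of_mem _ ha, ha'⟩
    · push Not at hJx
      obtain ⟨w, hw, hwJ, hxw⟩ := hJx
      have hxw' : x < w := lt_of_le_of_ne hxw fun h => hx (h ▸ hw)
      have hIw : (I.2 : ℝ) ≤ w := by
        by_contra h
        exact (hIx w hw (not_le.1 h)).not_ge hxw
      have hwJ' : w ∈ Set.Ioo (J.1 : ℝ) J.2 := by
        obtain ⟨K, hK, hwK⟩ := hcov w hw hIw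
        rcases List.mem_cons.1 hK with rfl | hK
        · exact hwK
        · exact absurd hwK.1 (by linarith [hlater K hK])
      refine ⟨(I.2 + J.1) / 2, by simp [gapPoints], fun z hz => out ?_⟩
      push_cast
      rcases lt_or_ge z (I.2 : ℝ) with h | h
      · exact .inl ⟨hIx z hz h, by linarith⟩
      · obtain ⟨K, hK, hzK⟩ := hcov z hz h
        rcases List.mem_cons.1 hK with rfl | hK
        · rw [huniq K (by simp) z hz w hw hzK hwJ']
          exact .inr ⟨hxw', by linarith [hwJ'.1]⟩
        · have := hlater K hK
          exact .inr ⟨by linarith [hzK.1], by linarith [hzK.1]⟩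

/-- The sample points meet every component of the complement of a set that is covered by the
intervals, if each of these contains at most one point of the set. -/
lemma exists_mem_samplePoints {Z : Set ℝ} {L : List (ℚ × ℚ)}
    (hpw : L.Pairwise (fun I J => I.2 ≤ J.1)) (hlt : ∀ J ∈ L, J.1 < J.2)
    (huniq : ∀ J ∈ L, ∀ z ∈ Z, ∀ w ∈ Z, z ∈ Set.Ioo (J.1 : ℝ) J.2 → w ∈ Set.Ioo (J.1 : ℝ) J.2 →
      z = w)
    (hcov : ∀ z ∈ Z, ∃ J ∈ L, z ∈ Set.Ioo (J.1 : ℝ) J.2) {x : ℝ} (hx : x ∉ Z) :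
    ∃ a ∈ samplePoints L, ∀ z ∈ Z, z ∉ Set.uIcc x (a : ℝ) := by
  cases L with
  | nil =>
    refine ⟨0, by simp [samplePoints], fun z hz => ?_⟩
    obtain ⟨J, hJ, -⟩ := hcov z hz
    simp at hJ
  | cons I L =>
    have hlater : ∀ K ∈ L, (I.2 : ℝ) ≤ K.1 := fun K hK => by
      exact_mod_cast (List.pairwise_cons.1 hpw).1 K hK
    have hI12 : (I.1 : ℝ) < I.2 := by exact_mod_cast hlt I (by simp)
    by_cases hIx : ∀ z ∈ Z, z < (I.2 : ℝ) → z < x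
    · obtain ⟨a, ha, ha'⟩ := exists_mem_gapPoints L I hpw hlt huniq (fun z hz hIz => by
        obtain ⟨K, hK, hzK⟩ := hcov z hz
        rcases List.mem_cons.1 hK with rfl | hK
        · exact (hzK.2.not_ge hIz).elim
        · exact ⟨K, hK, hzK⟩) x hx hIx
      exact ⟨a, List.mem_cons_of_mem _ ha, ha'⟩
    · push Not at hIx
      obtain ⟨w, hw, hwI, hxw⟩ := hIx
      have hxw' : x < w := lt_of_le_of_ne hxw fun h => hx (h ▸ hw)
      have hw' : w ∈ Set.Ioo (I.1 : ℝ) I.2 := by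
        obtain ⟨K, hK, hwK⟩ := hcov w hw
        rcases List.mem_cons.1 hK with rfl | hK
        · exact hwK
        · exact absurd hwK.1 (by linarith [hlater K hK])
      refine ⟨I.1 - 1, by simp [samplePoints], fun z hz hz' => ?_⟩
      have hgt : x < z ∧ (I.1 : ℝ) - 1 < z := by
        obtain ⟨K, hK, hzK⟩ := hcov z hz
        rcases List.mem_cons.1 hK with rfl | hK
        · rw [huniq K (by simp) z hz w hw hzK hw']
          exact ⟨hxw', by linarith [hw'.1]⟩
        · have := hlater K hK
          exact ⟨by linarith [hzK.1], by linarith [hzK.1]⟩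
      rw [Set.mem_uIcc] at hz'
      push_cast at hz'
      rcases hz' with h | h <;> linarith [h.1, h.2, hgt.1, hgt.2]

/-! ### The square-free part -/

lemma mul_squarefreePart {q : ℚ[X]} (hq : q ≠ 0) :
    EuclideanDomain.gcd q (derivative q) * squarefreePart q = q :=
  EuclideanDomain.mul_div_cancel' (fun h => hq (EuclideanDomain.gcd_eq_zero_iff.1 h).1)
    (EuclideanDomain.gcd_dvd_left _ _)

lemma aeval_squarefreePart_ne_zero {K : Type*} [Field K] [Algebra ℚ K] {q : ℚ[X]} (hq : q ≠ 0)
    {z : K} (h : aeval z q ≠ 0) : aeval z (squarefreePart q) ≠ 0 := fun h0 => h (by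
  rw [← mul_squarefreePart hq, map_mul, h0, mul_zero])

/-- Roots of `q` are simple roots of its square-free part: a root of multiplicity `k` of `q` has
multiplicity `k - 1` in `q'`, hence in `gcd(q, q')`. -/
lemma aeval_squarefreePart {K : Type*} [Field K] [CharZero K] [Algebra ℚ K] {q : ℚ[X]}
    (hq : q ≠ 0) {z : K} (h : aeval z q = 0) :
    aeval z (squarefreePart q) = 0 ∧ aeval z (derivative (squarefreePart q)) ≠ 0 := by
  let f := algebraMap ℚ K
  have hf : Function.Injective f := f.injective
  set g := EuclideanDomain.gcd q (derivative q) with hg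
  set s := squarefreePart q with hs
  have hgs : g.map f * s.map f = q.map f := by
    rw [← Polynomial.map_mul, mul_squarefreePart hq]
  have hQ : q.map f ≠ 0 := (Polynomial.map_ne_zero_iff hf).2 hq
  have hroot : (q.map f).IsRoot z := by rwa [IsRoot.def, eval_map_algebraMap]
  have hG : g.map f ≠ 0 := left_ne_zero_of_mul (hgs ▸ hQ)
  have hS : s.map f ≠ 0 := right_ne_zero_of_mul (hgs ▸ hQ)
  have hQ' : derivative (q.map f) ≠ 0 := fun h0 => by
    have h1 := derivative_eq_zero.1 h0
    rw [eq_C_of_natDegree_eq_zero h1, IsRoot.def, eval_C] at hroot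
    exact hQ (by rw [eq_C_of_natDegree_eq_zero h1, hroot, C_0])
  have hder := derivative_rootMultiplicity_of_root hroot
  have hmul := rootMultiplicity_mul (x := z) (p := g.map f) (q := s.map f) (hgs ▸ hQ)
  rw [hgs] at hmul
  have hpos := (rootMultiplicity_pos hQ).2 hroot
  have hle : (g.map f).rootMultiplicity z ≤ (q.map f).rootMultiplicity z - 1 := by
    rw [← hder, le_rootMultiplicity_iff hQ', derivative_map]
    exact (pow_rootMultiplicity_dvd _ _).trans
      (Polynomial.map_dvd f (EuclideanDomain.gcd_dvd_right _ _))
  have hge : (q.map f).rootMultiplicity z - 1 ≤ (g.map f).rootMultiplicity z := by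
    rw [le_rootMultiplicity_iff hG, hg, EuclideanDomain.gcd_eq_gcd_ab, Polynomial.map_add,
      Polynomial.map_mul, Polynomial.map_mul, ← derivative_map]
    refine dvd_add (Dvd.dvd.mul_right ?_ _) (Dvd.dvd.mul_right ?_ _)
    · exact (pow_dvd_pow _ (Nat.sub_le _ _)).trans (pow_rootMultiplicity_dvd _ _)
    · rw [← hder]
      exact pow_rootMultiplicity_dvd _ _
  have hone : (s.map f).rootMultiplicity z = 1 := by omega
  have h1 : (s.map f).IsRoot z := (rootMultiplicity_pos hS).1 (by omega)
  refine ⟨by rwa [IsRoot.def, eval_map_algebraMap] at h1, fun h2 => ?_⟩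
  have := (one_lt_rootMultiplicity_iff_isRoot hS).2
    ⟨h1, by rwa [IsRoot.def, derivative_map, eval_map_algebraMap]⟩
  omega

lemma isCoprime_squarefreePart {q : ℚ[X]} (hq : q ≠ 0) :
    IsCoprime (squarefreePart q) (derivative (squarefreePart q)) := by
  refine (isCoprime_iff_aeval_ne_zero_of_isAlgClosed _ ℂ _ _).2 fun z => ?_
  by_cases h : aeval z q = 0
  · exact .inr (aeval_squarefreePart hq h).2
  · exact .inl (aeval_squarefreePart_ne_zero hq h)

/-! ### Bounds for roots and for their distances -/

lemma abs_aeval_le_absBound (q : ℚ[X]) {x : ℝ} {B : ℚ} (hx : |x| ≤ B) :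
    |aeval x q| ≤ absBound q B := by
  rw [aeval_def, eval₂_eq_sum, absBound, Polynomial.sum, Polynomial.sum, Rat.cast_sum]
  refine (Finset.abs_sum_le_sum_abs _ _).trans (Finset.sum_le_sum fun i _ => ?_)
  rw [abs_mul, abs_pow, eq_ratCast, Rat.cast_mul, Rat.cast_abs, Rat.cast_pow]
  gcongr

lemma one_le_rootBound (q : ℚ[X]) : 1 ≤ rootBound q :=
  le_add_of_nonneg_right (Finset.sum_nonneg fun _ _ => abs_nonneg _)

lemma abs_lt_rootBound {q : ℚ[X]} (hq : q ≠ 0) {x : ℝ} (h : aeval x q = 0) :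
    |x| < rootBound q := by
  let f := algebraMap ℚ ℝ
  have hQ : q.map f ≠ 0 := (Polynomial.map_ne_zero_iff f.injective).2 hq
  have hroot : (q.map f).IsRoot x := by rwa [IsRoot.def, eval_map_algebraMap]
  have h1 : |x| < cauchyBound (q.map f) := hroot.norm_lt_cauchyBound hQ
  refine h1.trans_le ?_
  have hlead : 0 < |(q.leadingCoeff : ℝ)| := by
    rw [abs_pos]
    exact_mod_cast leadingCoeff_ne_zero.2 hq
  set S : ℚ := q.sum fun _ a => |a / q.leadingCoeff| with hS
  have hS0 : (0 : ℝ) ≤ S := by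
    exact_mod_cast (Finset.sum_nonneg fun _ _ => abs_nonneg _ : 0 ≤ S)
  have hcoeff : ∀ i, |(q.coeff i : ℝ)| ≤ S * |(q.leadingCoeff : ℝ)| := by
    intro i
    by_cases hi : i ∈ q.support
    · have h2 : |q.coeff i / q.leadingCoeff| ≤ S :=
        Finset.single_le_sum (f := fun j => |q.coeff j / q.leadingCoeff|)
          (fun _ _ => abs_nonneg _) hi
      rw [← div_le_iff₀ hlead, ← abs_div]
      exact_mod_cast h2
    · rw [notMem_support_iff.1 hi]
      simpa using mul_nonneg hS0 hlead.le
  have hsup : ((Finset.range (q.map f).natDegree).sup (‖(q.map f).coeff ·‖₊)) ≤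
      Real.toNNReal (S * |(q.leadingCoeff : ℝ)|) := by
    refine Finset.sup_le fun i _ => ?_
    rw [← NNReal.coe_le_coe, Real.coe_toNNReal _ (mul_nonneg hS0 hlead.le), coe_nnnorm, coeff_map]
    exact hcoeff i
  rw [cauchyBound, rootBound, ← hS, leadingCoeff_map]
  push_cast
  rw [add_comm]
  gcongr
  have hf : ‖f q.leadingCoeff‖ = |(q.leadingCoeff : ℝ)| := rfl
  rw [hf, div_le_iff₀ hlead, ← Real.coe_toNNReal _ (mul_nonneg hS0 hlead.le), NNReal.coe_le_coe]
  exact hsup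

/-- Four cells of the isolating grid fit between two different real roots. By Rolle's theorem
there is a zero of `s'` between them, whereas `|s'|` is bounded below at the roots by the Bézout
identity `u s + v s' = c`. -/
lemma four_mul_cell_lt {s : ℚ[X]} (hs : IsCoprime s (derivative s)) (hs0 : s ≠ 0) {α β : ℝ}
    (hα : aeval α s = 0) (hβ : aeval β s = 0) (hαβ : α < β) :
    4 * (2 * (rootBound s : ℝ) / gridSize s) < β - α := by
  set B : ℚ := rootBound s with hB
  set v := EuclideanDomain.gcdB s (derivative s) with hv
  set c : ℚ := (EuclideanDomain.gcd s (derivative s)).coeff 0 with hc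
  set V : ℚ := absBound v B with hV
  set W : ℚ := absBound (derivative (derivative s)) B with hW
  have hunit : IsUnit (EuclideanDomain.gcd s (derivative s)) :=
    EuclideanDomain.gcd_isUnit_iff.2 hs
  have hgcd : EuclideanDomain.gcd s (derivative s) = C c :=
    eq_C_of_natDegree_eq_zero (natDegree_eq_zero_of_isUnit hunit)
  have hc0 : 0 < |c| := by
    rw [abs_pos]
    rintro h
    rw [hgcd, h, C_0] at hunit
    exact not_isUnit_zero hunit
  have hαB : |α| < B := abs_lt_rootBound hs0 hα
  have hβB : |β| < B := abs_lt_rootBound hs0 hβ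
  have hbez : (c : ℝ) = aeval α (derivative s) * aeval α v := by
    have h1 := congrArg (aeval α) (EuclideanDomain.gcd_eq_gcd_ab s (derivative s))
    rw [hgcd, map_add, map_mul, map_mul, hα, zero_mul, zero_add, aeval_C] at h1
    exact h1
  have h1 : |(c : ℝ)| ≤ |aeval α (derivative s)| * V := by
    rw [hbez, abs_mul]
    gcongr
    exact abs_aeval_le_absBound v hαB.le
  obtain ⟨ξ, hξ, hξ0⟩ := exists_deriv_eq_zero (f := fun x => aeval x s) hαβ
    (Polynomial.continuous_aeval s).continuousOn (hα.trans hβ.symm)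
  rw [Polynomial.deriv_aeval] at hξ0
  have h2 : |aeval α (derivative s)| ≤ W * (ξ - α) := by
    obtain ⟨η, hη, hη'⟩ := exists_deriv_eq_slope (fun x => aeval x (derivative s)) hξ.1
      (Polynomial.continuous_aeval _).continuousOn
      (Polynomial.differentiable_aeval _).differentiableOn
    rw [Polynomial.deriv_aeval, hξ0, zero_sub, eq_div_iff (by linarith [hξ.1])] at hη'
    rw [← abs_neg, ← hη', abs_mul, abs_of_pos (sub_pos.2 hξ.1)]
    refine mul_le_mul_of_nonneg_right (abs_aeval_le_absBound _ ?_) (sub_pos.2 hξ.1).le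
    rw [abs_lt] at hαB hβB
    rw [abs_le]
    constructor <;> linarith [hη.1, hη.2, hξ.1, hξ.2]
  have hV0 : (0 : ℝ) ≤ V := (abs_nonneg _).trans (abs_aeval_le_absBound v hαB.le)
  have hW0 : (0 : ℝ) ≤ W := (abs_nonneg _).trans (abs_aeval_le_absBound _ hαB.le)
  have hc0' : 0 < |(c : ℝ)| := by exact_mod_cast hc0
  have h3 : |(c : ℝ)| ≤ W * (ξ - α) * V := h1.trans (by gcongr)
  have hVW : 0 < (V : ℝ) * W := by
    refine lt_of_le_of_ne (mul_nonneg hV0 hW0) fun h => ?_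
    have : (W : ℝ) * (ξ - α) * V = 0 := by linear_combination (ξ - α) * (-h)
    linarith
  have h4 : |(c : ℝ)| < V * W * (β - α) := by
    refine h3.trans_lt ?_
    have := mul_lt_mul_of_pos_left (sub_lt_sub_right hξ.2 α) hVW
    linarith
  have hN : (8 : ℝ) * B * V * W / |(c : ℝ)| < gridSize s := by
    have h5 : 8 * B * V * W / |c| < gridSize s := by
      rw [gridSize, Nat.cast_add, Nat.cast_one]
      exact (Nat.le_ceil _).trans_lt (lt_add_one _)
    exact_mod_cast h5
  have hN0 : (0 : ℝ) < gridSize s := by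
    rw [gridSize]
    positivity
  rw [div_lt_iff₀ hc0'] at hN
  have h6 : (8 : ℝ) * B * (V * W) < gridSize s * (β - α) * (V * W) := by
    calc (8 : ℝ) * B * (V * W) = 8 * B * V * W := by ring
      _ < gridSize s * |(c : ℝ)| := hN
      _ < gridSize s * (V * W * (β - α)) := mul_lt_mul_of_pos_left h4 hN0
      _ = _ := by ring
  have h7 := lt_of_mul_lt_mul_right h6 hVW.le
  rw [← mul_div_assoc, div_lt_iff₀ hN0]
  linarith

/-! ### Root isolation -/

/-- A polynomial changes sign at a simple root. -/
lemma eval_mul_eval_neg_of_simple_root {S : ℝ[X]} {a b r : ℝ} (hr : r ∈ Set.Ioo a b)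
    (h0 : S.eval r = 0) (h1 : S.derivative.eval r ≠ 0)
    (huniq : ∀ x ∈ Set.Icc a b, S.eval x = 0 → x = r) : S.eval a * S.eval b < 0 := by
  obtain ⟨t, rfl⟩ := dvd_iff_isRoot.2 h0
  have hab : a ≤ b := (hr.1.trans hr.2).le
  have ht : ∀ x ∈ Set.Icc a b, t.eval x ≠ 0 := by
    intro x hx hx0
    obtain rfl := huniq x hx (by simp [hx0])
    exact h1 (by simp [hx0])
  have hpos : 0 < t.eval a * t.eval b := by
    by_contra hneg
    obtain ⟨x, hx, hx0⟩ : (0 : ℝ) ∈ t.eval '' Set.uIcc a b := by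
      refine intermediate_value_uIcc t.continuous.continuousOn ?_
      rw [Set.mem_uIcc]
      rcases mul_nonpos_iff.1 (not_lt.1 hneg) with h | h
      · exact .inr ⟨h.2, h.1⟩
      · exact .inl ⟨h.1, h.2⟩
    exact ht x (Set.uIcc_of_le hab ▸ hx) hx0
  have h2 : (a - r) * (b - r) < 0 :=
    mul_neg_of_neg_of_pos (sub_neg.2 hr.1) (sub_pos.2 hr.2)
  have h3 : eval a ((X - C r) * t) * eval b ((X - C r) * t) =
      (a - r) * (b - r) * (t.eval a * t.eval b) := by
    simp only [eval_mul, eval_sub, eval_X, eval_C]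
    ring
  rw [h3]
  exact mul_neg_of_neg_of_pos h2 hpos

lemma aeval_ratCast (s : ℚ[X]) (g : ℚ) : aeval (g : ℝ) s = ((s.eval g : ℚ) : ℝ) := by
  have := aeval_algebraMap_apply ℝ g s
  simpa [coe_aeval_eq_eval] using this

/-- Correctness of root isolation. -/
theorem isolateRoots_spec {q : ℚ[X]} (hq : q ≠ 0) :
    (isolateRoots q).Pairwise (fun I J => I.2 ≤ J.1) ∧
    (∀ J ∈ isolateRoots q, J.1 < J.2) ∧
    (∀ J ∈ isolateRoots q, ∀ z : ℝ, aeval z q = 0 → ∀ w : ℝ, aeval w q = 0 →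
      z ∈ Set.Ioo (J.1 : ℝ) J.2 → w ∈ Set.Ioo (J.1 : ℝ) J.2 → z = w) ∧
    (∀ z : ℝ, aeval z q = 0 → ∃ J ∈ isolateRoots q, z ∈ Set.Ioo (J.1 : ℝ) J.2) := by
  have hroots : ∀ {z : ℝ}, aeval z q = 0 → aeval z (squarefreePart q) = 0 := fun h =>
    (aeval_squarefreePart hq h).1
  have hsimple : ∀ {z : ℝ}, aeval z (squarefreePart q) = 0 →
      aeval z (derivative (squarefreePart q)) ≠ 0 := fun {z} h => by
    by_cases hz : aeval z q = 0
    · exact (aeval_squarefreePart hq hz).2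
    · exact (aeval_squarefreePart_ne_zero hq hz h).elim
  have hs0 : squarefreePart q ≠ 0 := fun h => hq (by rw [← mul_squarefreePart hq, h, mul_zero])
  have hsep : ∀ {α β : ℝ}, _ → _ → _ → _ := fun {α β} =>
    four_mul_cell_lt (α := α) (β := β) (isCoprime_squarefreePart hq) hs0
  have hbound : ∀ {z : ℝ}, aeval z (squarefreePart q) = 0 → _ := fun {z} =>
    abs_lt_rootBound (x := z) hs0
  have hBpos : 0 < rootBound (squarefreePart q) := one_pos.trans_le (one_le_rootBound _)
  have hNpos : 0 < gridSize (squarefreePart q) := Nat.succ_pos _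
  unfold isolateRoots
  generalize squarefreePart q = s at *
  simp only
  generalize rootBound s = B at *
  generalize gridSize s = N at *
  have hN0 : (0 : ℚ) < N := by exact_mod_cast hNpos
  set h : ℚ := 2 * B / N with hh
  have hpos : 0 < h := by positivity
  have hposR : (0 : ℝ) < h := by exact_mod_cast hpos
  have hsep' : ∀ {α β : ℝ}, aeval α s = 0 → aeval β s = 0 → α < β → 4 * (h : ℝ) < β - α := by
    intro α β hα hβ hαβ
    have := hsep hα hβ hαβ
    rw [hh]
    push_cast
    exact this
  -- a root in the cell at `g` is detected by the test, and the test is passed only if there is one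
  have hcell : ∀ g : ℚ, (s.eval g = 0 ∨ s.eval g * s.eval (g + h) < 0) →
      ∃ r : ℝ, aeval r s = 0 ∧ (g : ℝ) ≤ r ∧ r < g + h := by
    rintro g (hg | hg)
    · exact ⟨g, by rw [aeval_ratCast, hg, Rat.cast_zero], le_rfl, by linarith⟩
    · have hgR : aeval (g : ℝ) s * aeval ((g : ℝ) + h) s < 0 := by
        have h1 : ((g : ℝ) + h) = ((g + h : ℚ) : ℝ) := by push_cast; rfl
        rw [h1, aeval_ratCast, aeval_ratCast]
        exact_mod_cast hg
      obtain ⟨r, hr, hr0⟩ : (0 : ℝ) ∈ (fun x => aeval x s) '' Set.uIcc (g : ℝ) (g + h) := by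
        refine intermediate_value_uIcc (Polynomial.continuous_aeval s).continuousOn ?_
        rw [Set.mem_uIcc]
        rcases mul_neg_iff.1 hgR with h | h
        · exact .inr ⟨h.2.le, h.1.le⟩
        · exact .inl ⟨h.1.le, h.2.le⟩
      rw [Set.uIcc_of_le (by linarith)] at hr
      refine ⟨r, hr0, hr.1, lt_of_le_of_ne hr.2 fun h1 => ?_⟩
      rw [← h1] at hgR
      exact hgR.ne (by rw [show aeval r s = 0 from hr0, mul_zero])
  have hcell' : ∀ (g : ℚ) (r : ℝ), aeval r s = 0 → (g : ℝ) ≤ r → r < g + h →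
      (s.eval g = 0 ∨ s.eval g * s.eval (g + h) < 0) := by
    intro g r hr hgr hrg
    by_cases hg : s.eval g = 0
    · exact .inl hg
    refine .inr ?_
    have hgr' : (g : ℝ) < r := lt_of_le_of_ne hgr fun h1 => hg (by
      rw [← h1, aeval_ratCast] at hr
      exact_mod_cast hr)
    have := eval_mul_eval_neg_of_simple_root (S := s.map (algebraMap ℚ ℝ)) (a := g) (b := g + h)
      ⟨hgr', hrg⟩ (by rwa [eval_map_algebraMap])
      (by rw [derivative_map, eval_map_algebraMap]; exact hsimple hr) (fun x hx hx0 => by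
        rw [eval_map_algebraMap] at hx0
        rcases lt_trichotomy x r with h1 | h1 | h1
        · linarith [hsep' hx0 hr h1, hx.1]
        · exact h1
        · linarith [hsep' hr hx0 h1, hx.2])
    have h1 : ((g : ℝ) + h) = ((g + h : ℚ) : ℝ) := by push_cast; rfl
    rw [eval_map_algebraMap, eval_map_algebraMap, h1, aeval_ratCast, aeval_ratCast] at this
    exact_mod_cast this
  -- the indices of the grid cells are coerced to rationals as a list, by a monadic bind
  have hlist : (do let k ← List.range N; pure (k : ℚ)) =
      (List.range N).map (fun k : ℕ => (k : ℚ)) := by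
    simp [List.map_eq_flatMap]
  rw [hlist, List.filterMap_map]
  have hmem : ∀ J : ℚ × ℚ, J ∈ (List.range N).filterMap ((fun a : ℚ =>
      if s.eval (-B + a * h) = 0 ∨
        s.eval (-B + a * h) * s.eval (-B + a * h + h) < 0
      then some (-B + a * h - h, -B + a * h + h) else none) ∘ fun k : ℕ => (k : ℚ)) ↔
      ∃ k < N, (s.eval (-B + (k : ℚ) * h) = 0 ∨
        s.eval (-B + (k : ℚ) * h) * s.eval (-B + (k : ℚ) * h + h) < 0) ∧
        (-B + (k : ℚ) * h - h, -B + (k : ℚ) * h + h) = J := by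
    intro J
    simp only [List.mem_filterMap, List.mem_range, Function.comp_apply,
      Option.ite_none_right_eq_some, Option.some.injEq]
  refine ⟨?_, ?_, ?_, ?_⟩
  · rw [List.pairwise_filterMap]
    refine List.pairwise_lt_range.imp ?_
    intro k l hkl I hI J hJ
    rw [Function.comp_apply, Option.ite_none_right_eq_some] at hI hJ
    obtain ⟨hk, hI⟩ := hI
    obtain ⟨hl, hJ⟩ := hJ
    obtain rfl := Option.some.inj hI
    obtain rfl := Option.some.inj hJ
    obtain ⟨r, hr, hr1, hr2⟩ := hcell _ hk
    obtain ⟨t, ht, ht1, ht2⟩ := hcell _ hl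
    have hkl' : -B + (k : ℚ) * h + h ≤ -B + (l : ℚ) * h := by
      have h1 : ((k + 1 : ℕ) : ℚ) ≤ l := by exact_mod_cast hkl
      have h2 := mul_le_mul_of_nonneg_right h1 hpos.le
      push_cast at h2
      linarith
    have hkl'' : ((-B + (k : ℚ) * h : ℚ) : ℝ) + h ≤ ((-B + (l : ℚ) * h : ℚ) : ℝ) := by
      exact_mod_cast hkl'
    have h3 := hsep' hr ht (by linarith)
    have h4 : ((-B + (k : ℚ) * h : ℚ) : ℝ) + 3 * h ≤ ((-B + (l : ℚ) * h : ℚ) : ℝ) := by linarith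
    have h5 : (-B + (k : ℚ) * h) + 3 * h ≤ (-B + (l : ℚ) * h) := by exact_mod_cast h4
    change -B + (k : ℚ) * h + h ≤ -B + (l : ℚ) * h - h
    linarith
  · intro J hJ
    obtain ⟨k, -, -, rfl⟩ := (hmem J).1 hJ
    change -B + (k : ℚ) * h - h < -B + (k : ℚ) * h + h
    linarith
  · intro J hJ z hz w hw hzJ hwJ
    obtain ⟨k, -, -, rfl⟩ := (hmem J).1 hJ
    simp only [Set.mem_Ioo] at hzJ hwJ
    push_cast at hzJ hwJ
    rcases lt_trichotomy z w with h1 | h1 | h1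
    · linarith [hsep' (hroots hz) (hroots hw) h1, hzJ.1, hwJ.2]
    · exact h1
    · linarith [hsep' (hroots hw) (hroots hz) h1, hzJ.2, hwJ.1]
  · intro z hz
    have hzs := hroots hz
    obtain ⟨hz1, hz2⟩ := abs_lt.1 (hbound hzs)
    have hy0 : 0 ≤ (z + B) / h := div_nonneg (by linarith) hposR.le
    set k := ⌊(z + B) / h⌋₊ with hk
    have hk1 : (k : ℝ) * h ≤ z + B := (le_div_iff₀ hposR).1 (Nat.floor_le hy0)
    have hk2 : z + B < (k + 1) * h := (div_lt_iff₀ hposR).1 (Nat.lt_floor_add_one _)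
    have hkN : k < N := by
      rw [hk, Nat.floor_lt hy0, div_lt_iff₀ hposR]
      have h1 : (N : ℝ) * h = 2 * B := by
        have : (N : ℚ) * h = 2 * B := by rw [hh]; field_simp
        exact_mod_cast this
      linarith
    refine ⟨_, (hmem _).2 ⟨k, hkN, hcell' _ z hzs ?_ ?_, rfl⟩, ?_⟩
    · push_cast; linarith
    · push_cast; linarith
    · constructor <;> push_cast <;> linarith

/-! ### The strict version of a specification -/

/-- The strict version of an atom that contains the output variable; other atoms are kept. -/
def hatAtom (p : MvPolynomial (Fin m ⊕ Fin 1) ℚ) (r : Rel) : Spec m 1 :=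
  .atom p (if HasOutput p then r.strict else r)

lemma hat_eq (φ : Spec m 1) : hat φ = φ.nnf.bind hatAtom := rfl

lemma cast_elim (A : Fin m → ℚ) (b : ℚ) :
    (fun i => ((Sum.elim A (fun _ : Fin 1 => b) i : ℚ) : ℝ)) =
      Sum.elim (fun i => (A i : ℝ)) fun _ => (b : ℝ) := by
  funext i
  rcases i with i | i <;> rfl

lemma holds_of_holds_hat {φ : Spec m 1} {K : Type*} [Field K] [LinearOrder K] [Algebra ℚ K]
    {v : Fin m ⊕ Fin 1 → K} (h : (hat φ).Holds v) : φ.Holds v := by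
  rw [← Formula.holds_nnf, ← Formula.bind_atom φ.nnf]
  refine φ.isNegFree_nnf.holds_bind_mono (fun p r _ h => ?_) h
  by_cases hp : HasOutput p
  · simp only [hp, if_true] at h
    exact Rel.Holds.of_strict h
  · simp only [hp, if_false] at h
    exact h

/-- The strict version of a specification holds on an open set of outputs. -/
lemma isOpen_holds_hat (φ : Spec m 1) (A : Fin m → ℝ) :
    IsOpen {y : ℝ | (hat φ).Holds (Sum.elim A fun _ => y)} := by
  have key : ∀ f : Spec m 1, f.IsNegFree →
      IsOpen {y : ℝ | (f.bind hatAtom).Holds (Sum.elim A fun _ => y)} := by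
    intro f
    induction f with
    | atom p r =>
      intro _
      by_cases hp : HasOutput p
      · have hc : Continuous fun y : ℝ => MvPolynomial.aeval (Sum.elim A fun _ => y) p := by
          simp only [← eval_map_asPolyInOutput]
          exact Polynomial.continuous _
        have := r.isOpen_strict.preimage hc
        simp only [Formula.bind, hatAtom, hp, if_true]
        exact this
      · have : ∀ y : ℝ, (hatAtom p r).Holds (Sum.elim A fun _ => y) ↔
            (hatAtom p r).Holds (Sum.elim A fun _ => (0 : ℝ)) := fun y => by
          simp only [hatAtom, Formula.Holds, aeval_eq_of_not_hasOutput hp A y 0]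
        simp only [Formula.bind, this]
        exact isOpen_const
    | not f _ => exact fun h => h.elim
    | and f g ihf ihg => exact fun h => (ihf h.1).inter (ihg h.2)
    | or f g ihf ihg => exact fun h => (ihf h.1).union (ihg h.2)
  exact key φ.nnf φ.isNegFree_nnf

lemma mem_nonStrict {φ : Spec m 1} {p : MvPolynomial (Fin m ⊕ Fin 1) ℚ} :
    p ∈ nonStrict φ ↔ HasOutput p ∧ ∃ r : Rel, r.IsNonStrict ∧ (p, r) ∈ φ.nnf.atoms := by
  simp only [nonStrict, List.mem_map, List.mem_filter, decide_eq_true_eq, Prod.exists,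
    exists_and_right, exists_eq_right]
  exact ⟨fun ⟨r, h1, h2, h3⟩ => ⟨h2, r, h3, h1⟩, fun ⟨h2, r, h3, h1⟩ => ⟨r, h1, h2, h3⟩⟩

lemma holds_hatAtom {p : MvPolynomial (Fin m ⊕ Fin 1) ℚ} {r : Rel} {v : Fin m ⊕ Fin 1 → ℚ}
    (h : r.Holds (MvPolynomial.aeval v p))
    (h0 : HasOutput p → r.IsNonStrict → MvPolynomial.aeval v p ≠ 0) : (hatAtom p r).Holds v := by
  by_cases hp : HasOutput p
  · simp only [hatAtom, hp, if_true]
    exact h.strict (h0 hp)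
  · simp only [hatAtom, hp, if_false]
    exact h

/-- If the strict version of the specification can be satisfied by a real output, then one of
the sample points satisfies it. -/
lemma exists_mem_rationalSamples {φ : Spec m 1} {A : Fin m → ℚ} {y : ℝ}
    (hy : (hat φ).Holds (Sum.elim (fun i => (A i : ℝ)) fun _ => y)) :
    ∃ a ∈ rationalSamples (hat φ) A, (hat φ).Holds (Sum.elim A fun _ => a) := by
  unfold rationalSamples
  set L := ((hat φ).atoms.map fun a => specialize A a.1).filter fun q => decide (q ≠ 0) with hL
  have hq : L.prod ≠ 0 := by
    refine List.prod_ne_zero fun h => ?_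
    simp [hL] at h
  obtain ⟨hpw, hlt, huniq, hcov⟩ := isolateRoots_spec hq
  have hfin : {z : ℝ | Polynomial.aeval z L.prod = 0}.Finite := by
    have := (L.prod.rootSet ℝ).toFinite
    refine this.subset fun z hz => ?_
    rw [Polynomial.mem_rootSet]
    exact ⟨hq, hz⟩
  obtain ⟨x, hx, hxq⟩ := ((infinite_of_mem_nhds y
    ((isOpen_holds_hat φ fun i => (A i : ℝ)).mem_nhds hy)).sdiff hfin).nonempty
  obtain ⟨a, ha, haZ⟩ := exists_mem_samplePoints (Z := {z : ℝ | Polynomial.aeval z L.prod = 0})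
    hpw hlt huniq hcov hxq
  refine ⟨a, ha, ?_⟩
  rw [← Formula.holds_cast, cast_elim]
  refine ((hat φ).holds_congr_sign _ _ fun b hb => ?_).1 hx
  rw [← aeval_specialize, ← aeval_specialize]
  by_cases h0 : specialize A b.1 = 0
  · simp [h0]
  refine sign_eq_of_ne_zero_on_uIcc (Polynomial.continuous_aeval _) fun t ht ht0 => haZ t ?_ ht
  have hdvd : specialize A b.1 ∣ L.prod := List.dvd_prod (by
    rw [hL, List.mem_filter]
    exact ⟨List.mem_map_of_mem hb, by simpa using h0⟩)
  obtain ⟨c, hc⟩ := hdvd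
  change Polynomial.aeval t L.prod = 0
  rw [hc, map_mul, ht0, zero_mul]

lemma eval_specialize (A : Fin m → ℚ) (p : MvPolynomial (Fin m ⊕ Fin 1) ℚ) (b : ℚ) :
    (specialize A p).eval b = MvPolynomial.aeval (Sum.elim A fun _ => b) p := by
  have h := aeval_specialize p A (b : ℝ)
  rw [aeval_ratCast, ← cast_elim] at h
  have h2 : MvPolynomial.aeval (fun i => ((Sum.elim A (fun _ : Fin 1 => b) i : ℚ) : ℝ)) p =
      ((MvPolynomial.aeval (Sum.elim A fun _ => b) p : ℚ) : ℝ) :=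
    MvPolynomial.aeval_algebraMap_apply ℝ (Sum.elim A fun _ : Fin 1 => b) p
  rw [h2] at h
  exact_mod_cast h

/-- Every rational solution at `A` that does not satisfy the strict version of the specification
is a root of a polynomial whose candidate roots are tried by the program. -/
def RootsCoverAt (φ : Spec m 1) (A : Fin m → ℚ) : Prop :=
  ∀ b : ℚ, φ.Holds (Sum.elim A fun _ => b) → ¬ (hat φ).Holds (Sum.elim A fun _ => b) →
    ∃ p ∈ nonStrict φ, specialize A p ≠ 0 ∧ (specialize A p).eval b = 0

lemma NonDegenerateAt.rootsCoverAt {φ : Spec m 1} {A : Fin m → ℚ} (h : NonDegenerateAt φ A) :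
    RootsCoverAt φ A := by
  intro b hb hb'
  by_contra! hno
  refine hb' ?_
  rw [← Formula.holds_nnf, ← Formula.bind_atom φ.nnf] at hb
  refine φ.isNegFree_nnf.holds_bind_mono (fun p r hpr hr => ?_) hb
  refine holds_hatAtom hr fun hp hrs => ?_
  have hmem : p ∈ nonStrict φ := mem_nonStrict.2 ⟨hp, r, hrs, hpr⟩
  rw [← eval_specialize]
  exact hno p hmem (h p hmem)

/-! ### The expansion of a specification -/

lemma holds_vanishes (p : MvPolynomial (Fin m ⊕ Fin 1) ℚ) {K : Type*} [Field K] [LinearOrder K]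
    [Algebra ℚ K] (v : Fin m ⊕ Fin 1 → K) : (vanishes p).Holds v ↔
      ∀ i, MvPolynomial.aeval (v ∘ Sum.inl) ((asPolyInOutput p).coeff i) = 0 := by
  have key : ∀ l : List ℕ, (l.foldr (fun i f => Formula.and (.eqZero (MvPolynomial.rename Sum.inl
      ((asPolyInOutput p).coeff i))) f) (.tru : Spec m 1)).Holds v ↔
      ∀ i ∈ l, MvPolynomial.aeval (v ∘ Sum.inl) ((asPolyInOutput p).coeff i) = 0 := by
    intro l
    induction l with
    | nil => simpa using Formula.holds_tru v
    | cons i l ih =>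
      rw [List.foldr_cons, List.forall_mem_cons]
      refine and_congr ?_ ih
      rw [Formula.holds_eqZero, MvPolynomial.aeval_rename]
  rw [vanishes, key]
  refine ⟨fun h i => ?_, fun h i _ => h i⟩
  by_cases hi : i ≤ (asPolyInOutput p).natDegree
  · exact h i (List.mem_range.2 (Nat.lt_succ_of_le hi))
  · rw [Polynomial.coeff_eq_zero_of_natDegree_lt (not_le.1 hi), map_zero]

lemma aeval_eq_zero_of_holds_vanishes {p : MvPolynomial (Fin m ⊕ Fin 1) ℚ}
    {v : Fin m ⊕ Fin 1 → ℝ} (h : (vanishes p).Holds v) : MvPolynomial.aeval v p = 0 := by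
  rw [holds_vanishes] at h
  have hv : v = Sum.elim (v ∘ Sum.inl) fun _ => v (Sum.inr 0) := by
    funext i
    rcases i with i | i
    · rfl
    · rw [Subsingleton.elim i 0]; rfl
  have h0 : (asPolyInOutput p).map (MvPolynomial.aeval (v ∘ Sum.inl) :
      MvPolynomial (Fin m) ℚ →ₐ[ℚ] ℝ).toRingHom = 0 := by
    ext i
    rw [Polynomial.coeff_map, Polynomial.coeff_zero]
    exact h i
  rw [hv, ← eval_map_asPolyInOutput, h0, Polynomial.eval_zero]

lemma specialize_eq_map (A : Fin m → ℚ) (p : MvPolynomial (Fin m ⊕ Fin 1) ℚ) :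
    specialize A p = (asPolyInOutput p).map
      (MvPolynomial.aeval A : MvPolynomial (Fin m) ℚ →ₐ[ℚ] ℚ).toRingHom := by
  unfold specialize asPolyInOutput
  induction p using MvPolynomial.induction_on with
  | C a =>
    simp only [MvPolynomial.aeval_C]
    rw [IsScalarTower.algebraMap_apply ℚ (MvPolynomial (Fin m) ℚ)
      (Polynomial (MvPolynomial (Fin m) ℚ)) a]
    simp
  | add p q hp hq => simp only [map_add, Polynomial.map_add, hp, hq]
  | mul_X p i hp =>
    rw [map_mul, hp, map_mul, Polynomial.map_mul]
    rcases i with i | i <;> simp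

lemma holds_vanishes_of_specialize_eq_zero {A : Fin m → ℚ}
    {p : MvPolynomial (Fin m ⊕ Fin 1) ℚ} (h : specialize A p = 0) (b : ℚ) :
    (vanishes p).Holds (Sum.elim A fun _ => b) := by
  rw [holds_vanishes]
  intro i
  have := congrArg (fun q => q.coeff i) h
  rw [specialize_eq_map] at this
  rw [Polynomial.coeff_map, Polynomial.coeff_zero] at this
  exact this

lemma bind_hatAtom_eq_self (f : Spec m 1) (h : ∀ a ∈ f.atoms, ¬ HasOutput a.1) :
    f.bind hatAtom = f := by
  induction f with
  | atom p r => simp [Formula.bind, hatAtom, h (p, r) (by simp [Formula.atoms])]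
  | not f ih => exact congrArg Formula.not (ih h)
  | and f g ihf ihg =>
    simp only [Formula.atoms, List.mem_append] at h
    exact congrArg₂ Formula.and (ihf fun a ha => h a (.inl ha)) (ihg fun a ha => h a (.inr ha))
  | or f g ihf ihg =>
    simp only [Formula.atoms, List.mem_append] at h
    exact congrArg₂ Formula.or (ihf fun a ha => h a (.inl ha)) (ihg fun a ha => h a (.inr ha))

lemma isNegFree_vanishes (p : MvPolynomial (Fin m ⊕ Fin 1) ℚ) : (vanishes p).IsNegFree := by
  unfold vanishes
  induction List.range ((asPolyInOutput p).natDegree + 1) with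
  | nil => trivial
  | cons i l ih => exact ⟨⟨trivial, trivial⟩, ih⟩

lemma not_hasOutput_of_mem_atoms_vanishes (p : MvPolynomial (Fin m ⊕ Fin 1) ℚ) :
    ∀ a ∈ (vanishes p).atoms, ¬ HasOutput a.1 := by
  unfold vanishes
  have hr : ∀ c : MvPolynomial (Fin m) ℚ,
      ¬ HasOutput (MvPolynomial.rename Sum.inl c : MvPolynomial (Fin m ⊕ Fin 1) ℚ) := fun c h => by
    have := MvPolynomial.vars_rename Sum.inl c h
    simp at this
  induction List.range ((asPolyInOutput p).natDegree + 1) with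
  | nil =>
    intro a ha
    simp only [List.foldr_nil, Formula.tru, Formula.atoms, List.mem_singleton] at ha
    simp [ha, HasOutput]
  | cons i l ih =>
    intro a ha
    simp only [List.foldr_cons, Formula.atoms, Formula.eqZero, List.mem_append,
      List.mem_singleton] at ha
    rcases ha with (rfl | rfl) | ha
    · exact hr _
    · exact hr _
    · exact ih a ha

/-- The formula that replaces an atom in the expansion of a specification. -/
def expandAtom (p : MvPolynomial (Fin m ⊕ Fin 1) ℚ) (r : Rel) : Spec m 1 :=
  if HasOutput p ∧ r.IsNonStrict then .or (.atom p r) (vanishes p) else .atom p r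

lemma expand_eq (φ : Spec m 1) : expand φ = φ.nnf.bind expandAtom := rfl

lemma isNegFree_expand (φ : Spec m 1) : (expand φ).IsNegFree := by
  refine φ.isNegFree_nnf.bind fun p r => ?_
  split_ifs
  · exact ⟨trivial, isNegFree_vanishes p⟩
  · trivial

lemma holds_expand (φ : Spec m 1) (v : Fin m ⊕ Fin 1 → ℝ) : (expand φ).Holds v ↔ φ.Holds v := by
  rw [← φ.holds_nnf]
  constructor
  · intro h
    rw [← Formula.bind_atom φ.nnf]
    refine φ.isNegFree_nnf.holds_bind_mono (fun p r _ h => ?_) h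
    split_ifs at h with hp
    · rcases h with h | h
      · exact h
      · change r.Holds _
        rw [aeval_eq_zero_of_holds_vanishes h]
        exact hp.2.holds_zero
    · exact h
  · intro h
    rw [← Formula.bind_atom φ.nnf] at h
    refine φ.isNegFree_nnf.holds_bind_mono (fun p r _ h => ?_) h
    split_ifs
    · exact .inl h
    · exact h

lemma holds_expand_rat (φ : Spec m 1) (v : Fin m ⊕ Fin 1 → ℚ) :
    (expand φ).Holds v ↔ φ.Holds v := by
  rw [← Formula.holds_cast, holds_expand, Formula.holds_cast]

/-- In the expansion, an atom whose polynomial vanishes identically at `A` is true because of its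
second disjunct, which is not affected by the passage to strict inequalities. -/
lemma rootsCoverAt_expand (φ : Spec m 1) (A : Fin m → ℚ) : RootsCoverAt (expand φ) A := by
  intro b hb hb'
  by_contra! hno
  refine hb' ?_
  have hbind : hat (expand φ) = φ.nnf.bind fun p r => (expandAtom p r).bind hatAtom := by
    rw [hat_eq, (isNegFree_expand φ).nnf_eq, expand_eq]
    exact Formula.bind_bind _ _ _
  rw [hbind]
  refine φ.isNegFree_nnf.holds_bind_mono (fun p r hpr hr => ?_) hb
  unfold expandAtom
  split_ifs at hr ⊢ with hp
  · by_cases h0 : specialize A p = 0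
    · refine .inr ?_
      rw [bind_hatAtom_eq_self _ (not_hasOutput_of_mem_atoms_vanishes p)]
      exact holds_vanishes_of_specialize_eq_zero h0 b
    rcases hr with hr | hr
    · refine .inl (holds_hatAtom hr fun _ _ => ?_)
      rw [← eval_specialize]
      refine hno p (mem_nonStrict.2 ⟨hp.1, r, hp.2, ?_⟩) h0
      rw [(isNegFree_expand φ).nnf_eq, expand_eq, Formula.atoms_bind]
      refine ⟨(p, r), hpr, ?_⟩
      simp [expandAtom, hp, Formula.atoms]
    · refine .inr ?_
      rwa [bind_hatAtom_eq_self _ (not_hasOutput_of_mem_atoms_vanishes p)]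
  · exact holds_hatAtom hr fun h1 h2 => (hp ⟨h1, h2⟩).elim

/-! ### Execution of the program -/

lemma runForAll_tryAll (χ : Spec m 1) (A : Fin m → ℚ) (k : ℕ) : ∀ (L : List ℚ)
    (σ : PVar m → ℚ), σ ∘ Sum.inl = A →
    (∃ a ∈ L, χ.Holds (Sum.elim A fun _ => a) ∧
      runForAll 0 ((Prog.cond (χ.rename (Sum.map id fun _ => 0))
        (.ret fun _ => Sum.inr 0) .skip : Prog m 1).run k) L σ =
        some (.returned (some fun _ => a))) ∨
    ((∀ a ∈ L, ¬ χ.Holds (Sum.elim A fun _ => a)) ∧ ∃ σ' : PVar m → ℚ, σ' ∘ Sum.inl = A ∧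
      runForAll 0 ((Prog.cond (χ.rename (Sum.map id fun _ => 0))
        (.ret fun _ => Sum.inr 0) .skip : Prog m 1).run k) L σ = some (.next σ')) := by
  intro L
  induction L with
  | nil => exact fun σ hσ => .inr ⟨by simp, σ, hσ, rfl⟩
  | cons a L ih =>
    intro σ hσ
    have hguard : (χ.rename (Sum.map id fun _ => 0)).Holds (Function.update σ (Sum.inr 0) a) ↔
        χ.Holds (Sum.elim A fun _ => a) := by
      rw [Formula.holds_rename]
      refine iff_of_eq (congrArg _ ?_)
      funext i
      rcases i with i | i
      · simp [← hσ]
      · simp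
    by_cases ha : χ.Holds (Sum.elim A fun _ => a)
    · refine .inl ⟨a, by simp, ha, ?_⟩
      rw [runForAll, Prog.run, if_pos (hguard.2 ha)]
      simp [Prog.run, andThen]
    · obtain ⟨τ, hτ, hτ'⟩ : ∃ τ : PVar m → ℚ, τ ∘ Sum.inl = A ∧
          (Prog.cond (χ.rename (Sum.map id fun _ => 0)) (.ret fun _ => Sum.inr 0) .skip :
            Prog m 1).run k (Function.update σ (Sum.inr 0) a) = some (.next τ) := by
        refine ⟨_, ?_, by rw [Prog.run, if_neg (mt hguard.1 ha), Prog.skip, Prog.run]⟩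
        funext i
        simp [← hσ]
      rw [runForAll, hτ', andThen]
      rcases ih τ hτ with ⟨c, hc, h1, h2⟩ | ⟨h1, h2⟩
      · exact .inl ⟨c, List.mem_cons_of_mem _ hc, h1, h2⟩
      · exact .inr ⟨List.forall_mem_cons.2 ⟨ha, h1⟩, h2⟩

/-- `tryAll` returns an element of the list for which the specification holds, or passes control
on with the inputs unchanged if there is none. -/
lemma run_tryAll (C : Call m) (χ : Spec m 1) (k : ℕ) {A : Fin m → ℚ} {σ : PVar m → ℚ}
    (hσ : σ ∘ Sum.inl = A) :
    (∃ a ∈ C.eval A, χ.Holds (Sum.elim A fun _ => a) ∧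
      (Prog.tryAll C χ).run k σ = some (.returned (some fun _ => a))) ∨
    ((∀ a ∈ C.eval A, ¬ χ.Holds (Sum.elim A fun _ => a)) ∧ ∃ σ' : PVar m → ℚ,
      σ' ∘ Sum.inl = A ∧ (Prog.tryAll C χ).run k σ = some (.next σ')) := by
  subst hσ
  exact runForAll_tryAll χ _ k _ σ rfl

lemma elim_eq (A : Fin m → ℚ) (B : Fin 1 → ℚ) : Sum.elim A B = Sum.elim A fun _ => B 0 := by
  congr 1
  funext i
  rw [Subsingleton.elim i 0]

lemma run_tryRoots (φ : Spec m 1) (k : ℕ) {A : Fin m → ℚ}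
    (ps : List (MvPolynomial (Fin m ⊕ Fin 1) ℚ)) : ∀ σ : PVar m → ℚ, σ ∘ Sum.inl = A →
    ∃ b : Option (Fin 1 → ℚ),
      (ps.foldr (fun p Q => Prog.seq (.tryAll (.candRatRoot p) φ) Q) .retBot).run k σ =
        some (.returned b) ∧
      (∀ B, b = some B → φ.Holds (Sum.elim A B)) ∧
      (b = none → ∀ p ∈ ps, ∀ a ∈ candRatRoot (specialize A p),
        ¬ φ.Holds (Sum.elim A fun _ => a)) := by
  induction ps with
  | nil => exact fun σ _ => ⟨none, rfl, by simp, by simp⟩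
  | cons p ps ih =>
    intro σ hσ
    rcases run_tryAll (.candRatRoot p) φ k hσ with ⟨a, -, ha, hrun⟩ | ⟨hno, τ, hτ, hrun⟩
    · refine ⟨some fun _ => a, ?_, fun B hB => ?_, by simp⟩
      · rw [List.foldr_cons, Prog.run, hrun, andThen]
      · obtain rfl := Option.some.inj hB
        exact ha
    · obtain ⟨b, h1, h2, h3⟩ := ih τ hτ
      refine ⟨b, ?_, h2, fun hb => List.forall_mem_cons.2 ⟨hno, h3 hb⟩⟩
      rw [List.foldr_cons, Prog.run, hrun, andThen, h1]

lemma run_progOne {φ : Spec m 1} {ψ : Formula (Fin m)} (hψ : IsElim ψ (hat φ)) (A : Fin m → ℚ)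
    (k : ℕ) : ∃ b : Option (Fin 1 → ℚ),
      (progOne φ ψ).run k (Sum.elim A fun _ => 0) = some (.returned b) ∧
      (∀ B, b = some B → φ.Holds (Sum.elim A B)) ∧
      (RootsCoverAt φ A → b = none → ∀ B, ¬ φ.Holds (Sum.elim A B)) := by
  have hguard : (ψ.rename Sum.inl).Holds (Sum.elim A fun _ : ℕ => (0 : ℚ)) ↔
      ∃ y : ℝ, (hat φ).Holds (Sum.elim (fun i => (A i : ℝ)) fun _ => y) := by
    rw [Formula.holds_rename, ← hψ, ← Formula.holds_cast]
    rfl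
  have hσ : (Sum.elim A fun _ : ℕ => (0 : ℚ)) ∘ Sum.inl = A := rfl
  rw [progOne, Prog.run]
  by_cases h : ∃ y : ℝ, (hat φ).Holds (Sum.elim (fun i => (A i : ℝ)) fun _ => y)
  · rw [if_pos (hguard.2 h)]
    obtain ⟨y, hy⟩ := h
    obtain ⟨a, ha, ha'⟩ := exists_mem_rationalSamples hy
    rcases run_tryAll (.rationalSamples (hat φ)) (hat φ) k hσ with
      ⟨c, -, hc, hrun⟩ | ⟨hno, -⟩
    · refine ⟨_, hrun, fun B hB => ?_, by simp⟩
      obtain rfl := Option.some.inj hB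
      exact holds_of_holds_hat hc
    · exact (hno a ha ha').elim
  · rw [if_neg (mt hguard.1 h)]
    obtain ⟨b, h1, h2, h3⟩ := run_tryRoots φ k (nonStrict φ) _ hσ
    refine ⟨b, h1, h2, fun hcov hb B hB => ?_⟩
    rw [elim_eq] at hB
    obtain ⟨p, hp, hp0, hroot⟩ := hcov (B 0) hB fun hhat => h ⟨(B 0 : ℝ), by
      rwa [← cast_elim, Formula.holds_cast]⟩
    exact h3 hb p hp _ (mem_candRatRoot hp0 hroot) hB

lemma progOne_soundAt {φ : Spec m 1} {ψ : Formula (Fin m)} (hψ : IsElim ψ (hat φ))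
    (A : Fin m → ℚ) : (progOne φ ψ).SoundAt φ A := by
  refine ⟨?_, fun B ⟨k, hk⟩ => ?_⟩
  · obtain ⟨b, hb, -⟩ := run_progOne hψ A 0
    exact ⟨b, 0, hb⟩
  · obtain ⟨b, hb, h, -⟩ := run_progOne hψ A k
    rw [hk] at hb
    obtain rfl : some B = b := by injection hb with h1; injection h1
    exact h B rfl

lemma progOne_realizesAt {φ : Spec m 1} {ψ : Formula (Fin m)} (hψ : IsElim ψ (hat φ))
    {A : Fin m → ℚ} (hA : RootsCoverAt φ A) : (progOne φ ψ).RealizesAt φ A := by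
  refine ⟨progOne_soundAt hψ A, fun ⟨k, hk⟩ => ?_, fun h => ?_⟩
  · obtain ⟨b, hb, -, h⟩ := run_progOne hψ A k
    rw [hk] at hb
    obtain rfl : none = b := by injection hb with h1; injection h1
    exact h hA rfl
  · obtain ⟨b, hb, h1, -⟩ := run_progOne hψ A 0
    cases b with
    | none => exact ⟨0, hb⟩
    | some B => exact (h B (h1 B rfl)).elim

end NRA

end

theorem mainTheorem1 {m : ℕ} (φ : NRA.Spec m 1) :
    -- the elimination formula needed by the construction exists, for `φ` and for its expansion
    (∃ ψ : NRA.Formula (Fin m), NRA.IsElim ψ (NRA.hat φ)) ∧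
    (∃ ψ : NRA.Formula (Fin m), NRA.IsElim ψ (NRA.hat (NRA.expand φ))) ∧
    -- the program built from `φ`
    (∀ ψ : NRA.Formula (Fin m), NRA.IsElim ψ (NRA.hat φ) →
      (∀ A : Fin m → ℚ, (NRA.progOne φ ψ).SoundAt φ A) ∧
      (∀ A : Fin m → ℚ, NRA.NonDegenerateAt φ A → (NRA.progOne φ ψ).RealizesAt φ A)) ∧
    -- the program built from the expansion of `φ`, an equivalent specification
    (∀ v : Fin m ⊕ Fin 1 → ℝ, (NRA.expand φ).Holds v ↔ φ.Holds v) ∧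
    (∀ ψ : NRA.Formula (Fin m), NRA.IsElim ψ (NRA.hat (NRA.expand φ)) →
      (NRA.progOne (NRA.expand φ) ψ).Realizes φ) := by
  refine ⟨NRA.exists_isElim _, NRA.exists_isElim _, fun ψ hψ => ⟨NRA.progOne_soundAt hψ,
    fun A hA => NRA.progOne_realizesAt hψ hA.rootsCoverAt⟩, NRA.holds_expand φ,
    fun ψ hψ A => ?_⟩
  simpa only [NRA.Prog.RealizesAt, NRA.Prog.SoundAt, NRA.holds_expand_rat] using
    NRA.progOne_realizesAt hψ (NRA.rootsCoverAt_expand φ A)
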